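/- Let $(M,g)$ be a compact connected smooth Riemannian manifold of dimension $m$ (without boundary), let $(N,h)$ be a smooth Riemannian manifold and let $\alpha>0$ be a constant. Let $u:M\to N$, $f:M\to\mathbb R$ and $\sigma:M\to\mathbb R$ be smooth and suppose that $(g,u,f,\sigma)$ is a gradient almost $(RH)_\alpha$ soliton, that is, $$Rc-\alpha\,\nabla u\otimes\nabla u+\mathrm{Hess} f=\sigma g,\qquad \tau_g u-\langle\nabla u,\nabla f\rangle=0,$$ where $\nabla u\otimes\nabla u=u^*h$ and $\tau_g u$ is the tension field of $u$. Put $S=R-\alpha|\nabla u|^2$, where $R$ is the scalar curvature of $g$, and $\sigma_*=\inf_M\sigma$. The soliton is called steady if $\sigma\equiv0$ on $M$, expanding if $\sigma<0$ on $M$, and trivial if $f$ is constant. Suppose that the soliton is steady, or that it is expanding and at least one of the two conditions $\Delta\sigma\le 0$ on $M$ and $S\equiv m\sigma_*$ on $M$ holds. Then the soliton is trivial, and $S\equiv m\sigma_*$ on $M$. -/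

import Mathlib

open scoped Manifold ContDiff

namespace RHSoliton

noncomputable section

/-! ### Riemannian geometry of a metric given in coordinates

`G` is the matrix field `y ↦ (g_{ij}(y))` of a metric on an open subset of `ℝᵐ`. -/

/-- The partial derivative `∂_i F (y)`. -/
def pd {m : ℕ} (i : Fin m) (F : EuclideanSpace ℝ (Fin m) → ℝ)
    (y : EuclideanSpace ℝ (Fin m)) : ℝ :=
  fderiv ℝ F y (EuclideanSpace.single i (1 : ℝ))

/-- Christoffel symbols
`Γ^k_{ij} = ½ g^{kl} (∂_i g_{jl} + ∂_j g_{il} - ∂_l g_{ij})`. -/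
def christoffel {m : ℕ} (G : EuclideanSpace ℝ (Fin m) → Matrix (Fin m) (Fin m) ℝ)
    (k i j : Fin m) (y : EuclideanSpace ℝ (Fin m)) : ℝ :=
  (1 / 2 : ℝ) * ∑ l, (G y)⁻¹ k l *
    (pd i (fun z => G z j l) y + pd j (fun z => G z i l) y - pd l (fun z => G z i j) y)

/-- The Ricci tensor
`R_{ij} = ∂_k Γ^k_{ij} - ∂_j Γ^k_{ik} + Γ^k_{kl} Γ^l_{ij} - Γ^k_{jl} Γ^l_{ik}`
of the Levi-Civita connection (the sign for which round spheres have positive curvature). -/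
def ricci {m : ℕ} (G : EuclideanSpace ℝ (Fin m) → Matrix (Fin m) (Fin m) ℝ)
    (i j : Fin m) (y : EuclideanSpace ℝ (Fin m)) : ℝ :=
  (∑ k, (pd k (christoffel G k i j) y - pd j (christoffel G k i k) y)) +
    ∑ k, ∑ l, (christoffel G k k l y * christoffel G l i j y -
      christoffel G k j l y * christoffel G l i k y)

/-- The Hessian `(Hess F)_{ij} = ∂_i ∂_j F - Γ^k_{ij} ∂_k F`. -/
def hess {m : ℕ} (G : EuclideanSpace ℝ (Fin m) → Matrix (Fin m) (Fin m) ℝ)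
    (F : EuclideanSpace ℝ (Fin m) → ℝ) (i j : Fin m) (y : EuclideanSpace ℝ (Fin m)) : ℝ :=
  pd i (pd j F) y - ∑ k, christoffel G k i j y * pd k F y

/-- The Laplace-Beltrami operator `Δ F = g^{ij} (Hess F)_{ij}`. -/
def lap {m : ℕ} (G : EuclideanSpace ℝ (Fin m) → Matrix (Fin m) (Fin m) ℝ)
    (F : EuclideanSpace ℝ (Fin m) → ℝ) (y : EuclideanSpace ℝ (Fin m)) : ℝ :=
  ∑ i, ∑ j, (G y)⁻¹ i j * hess G F i j y

/-- The pullback metric `(∇U ⊗ ∇U)_{ij} = h_{νγ}(U) ∂_i U^ν ∂_j U^γ`. -/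
def pull {m n : ℕ} (H : EuclideanSpace ℝ (Fin n) → Matrix (Fin n) (Fin n) ℝ)
    (U : EuclideanSpace ℝ (Fin m) → EuclideanSpace ℝ (Fin n))
    (i j : Fin m) (y : EuclideanSpace ℝ (Fin m)) : ℝ :=
  ∑ a, ∑ b, H (U y) a b * pd i (fun z => U z a) y * pd j (fun z => U z b) y

/-- The tensor `S_{ij} = R_{ij} - α ∇_i u ∇_j u`. -/
def scTensor {m n : ℕ} (α : ℝ) (G : EuclideanSpace ℝ (Fin m) → Matrix (Fin m) (Fin m) ℝ)
    (H : EuclideanSpace ℝ (Fin n) → Matrix (Fin n) (Fin n) ℝ)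
    (U : EuclideanSpace ℝ (Fin m) → EuclideanSpace ℝ (Fin n))
    (i j : Fin m) (y : EuclideanSpace ℝ (Fin m)) : ℝ :=
  ricci G i j y - α * pull H U i j y

/-- The tension field
`τ(U)^ν = g^{ij} (∂_i ∂_j U^ν - Γ^k_{ij} ∂_k U^ν + Γ̃^ν_{βγ}(U) ∂_i U^β ∂_j U^γ)`,
where `Γ̃` are the Christoffel symbols of the target metric. -/
def tension {m n : ℕ} (G : EuclideanSpace ℝ (Fin m) → Matrix (Fin m) (Fin m) ℝ)
    (H : EuclideanSpace ℝ (Fin n) → Matrix (Fin n) (Fin n) ℝ)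
    (U : EuclideanSpace ℝ (Fin m) → EuclideanSpace ℝ (Fin n))
    (ν : Fin n) (y : EuclideanSpace ℝ (Fin m)) : ℝ :=
  ∑ i, ∑ j, (G y)⁻¹ i j * (hess G (fun z => U z ν) i j y +
    ∑ b, ∑ c, christoffel H ν b c (U y) * pd i (fun z => U z b) y * pd j (fun z => U z c) y)

/-- The contraction `⟨∇U, ∇F⟩^ν = g^{ij} ∂_i U^ν ∂_j F`. -/
def gradPair {m n : ℕ} (G : EuclideanSpace ℝ (Fin m) → Matrix (Fin m) (Fin m) ℝ)
    (U : EuclideanSpace ℝ (Fin m) → EuclideanSpace ℝ (Fin n))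
    (F : EuclideanSpace ℝ (Fin m) → ℝ) (ν : Fin n) (y : EuclideanSpace ℝ (Fin m)) : ℝ :=
  ∑ i, ∑ j, (G y)⁻¹ i j * pd i (fun z => U z ν) y * pd j F y

/-! ### Riemannian manifolds -/

/-- A smooth Riemannian metric on an `m`-dimensional smooth manifold. -/
abbrev RMetric (m : ℕ) (M : Type*) [TopologicalSpace M]
    [ChartedSpace (EuclideanSpace ℝ (Fin m)) M] [IsManifold (𝓡 m) ∞ M] : Type _ :=
  Bundle.ContMDiffRiemannianMetric (𝓡 m) ∞ (EuclideanSpace ℝ (Fin m))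
    (fun x : M => TangentSpace (𝓡 m) x)

section Manifold

variable {m n : ℕ}
  {M : Type*} [TopologicalSpace M] [ChartedSpace (EuclideanSpace ℝ (Fin m)) M]
  [IsManifold (𝓡 m) ∞ M]
  {N : Type*} [TopologicalSpace N] [ChartedSpace (EuclideanSpace ℝ (Fin n)) N]
  [IsManifold (𝓡 n) ∞ N]

/-- The coordinate vector field `∂_i` of the chart around `p`, at the point with
coordinates `y`. -/
def coordVec (p : M) (i : Fin m) (y : EuclideanSpace ℝ (Fin m)) :
    TangentSpace (𝓡 m) ((extChartAt (𝓡 m) p).symm y) :=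
  mfderiv 𝓘(ℝ, EuclideanSpace ℝ (Fin m)) (𝓡 m) (extChartAt (𝓡 m) p).symm y
    (EuclideanSpace.single i (1 : ℝ))

/-- The components `g_{ij} = g(∂_i, ∂_j)` of `g` in the chart around `p`. -/
def gCoord (g : RMetric m M) (p : M) (y : EuclideanSpace ℝ (Fin m)) :
    Matrix (Fin m) (Fin m) ℝ :=
  Matrix.of fun i j =>
    g.inner ((extChartAt (𝓡 m) p).symm y) (coordVec p i y) (coordVec p j y)

/-- A real function in the chart around `p`. -/
def fCoord (f : M → ℝ) (p : M) (y : EuclideanSpace ℝ (Fin m)) : ℝ :=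
  f ((extChartAt (𝓡 m) p).symm y)

/-- A map `u : M → N` in the chart around `p` of `M` and the chart around `r` of `N`. -/
def uCoord (u : M → N) (p : M) (r : N) (y : EuclideanSpace ℝ (Fin m)) :
    EuclideanSpace ℝ (Fin n) :=
  extChartAt (𝓡 n) r (u ((extChartAt (𝓡 m) p).symm y))

/-- The Laplace-Beltrami operator `Δ f` on `(M, g)`. -/
def laplaceBeltrami (g : RMetric m M) (f : M → ℝ) (x : M) : ℝ :=
  lap (gCoord g x) (fCoord f x) (extChartAt (𝓡 m) x x)

/-- The function `S = g^{ij} S_{ij} = R - α |∇u|²` on `M`. -/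
def scalarS (α : ℝ) (g : RMetric m M) (h : RMetric n N) (u : M → N) (x : M) : ℝ :=
  ∑ i, ∑ j, (gCoord g x (extChartAt (𝓡 m) x x))⁻¹ i j *
    scTensor α (gCoord g x) (gCoord h (u x)) (uCoord u x (u x)) i j (extChartAt (𝓡 m) x x)

/-- `(g, u, f, σ)` is a gradient almost `(RH)_α` soliton: `α > 0`, the data are smooth, and
`Rc - α ∇u ⊗ ∇u + Hess f = σ g` and `τ_g u = ⟨∇u, ∇f⟩`.
Both equations are between tensors; they are written in components, in every chart of the
given atlases of `M` and `N` and at every point where the charts are defined. -/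
structure IsGradientAlmostRHSoliton (α : ℝ) (g : RMetric m M) (h : RMetric n N)
    (u : M → N) (f σ : M → ℝ) : Prop where
  alpha_pos : 0 < α
  smooth_u : ContMDiff (𝓡 m) (𝓡 n) ∞ u
  smooth_f : ContMDiff (𝓡 m) 𝓘(ℝ, ℝ) ∞ f
  smooth_sigma : ContMDiff (𝓡 m) 𝓘(ℝ, ℝ) ∞ σ
  ricci_eq : ∀ (p : M) (r : N) (x : M), x ∈ (extChartAt (𝓡 m) p).source →
    u x ∈ (extChartAt (𝓡 n) r).source → ∀ i j : Fin m,
      scTensor α (gCoord g p) (gCoord h r) (uCoord u p r) i j (extChartAt (𝓡 m) p x) +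
        hess (gCoord g p) (fCoord f p) i j (extChartAt (𝓡 m) p x) =
      σ x * gCoord g p (extChartAt (𝓡 m) p x) i j
  tension_eq : ∀ (p : M) (r : N) (x : M), x ∈ (extChartAt (𝓡 m) p).source →
    u x ∈ (extChartAt (𝓡 n) r).source → ∀ ν : Fin n,
      tension (gCoord g p) (gCoord h r) (uCoord u p r) ν (extChartAt (𝓡 m) p x) -
        gradPair (gCoord g p) (uCoord u p r) (fCoord f p) ν (extChartAt (𝓡 m) p x) = 0

end Manifold

/-- Steady: `σ` vanishes on `M`. -/
def IsSteady {M : Type*} (σ : M → ℝ) : Prop := ∀ x, σ x = 0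

/-- Expanding: `σ` is negative on `M`. -/
def IsExpanding {M : Type*} (σ : M → ℝ) : Prop := ∀ x, σ x < 0

/-- Trivial: the potential `f` is constant. -/
def IsTrivial {M : Type*} (f : M → ℝ) : Prop := ∃ c : ℝ, ∀ x, f x = c

end

end RHSoliton

/-! Tracing the soliton equation gives `S + Δf = mσ`. If `S ≡ mσ_*`, then `Δf = m(σ - σ_*) ≥ 0`, and
a subharmonic function on a compact connected manifold is constant by Hopf's strong maximum
principle. In the other cases `σ` is a constant `c ≤ 0`: zero when steady, and when `Δσ ≤ 0` because
`σ` is superharmonic.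

For constant `σ = c` the key is Hamilton's identity: `Δf - |∇f|² + 2cf` is constant
(`exists_hamilton_const`). At a minimum of `f` one has `∇f = 0` and `Δf ≥ 0`; comparing an arbitrary
`z` with a minimum point `x₀` gives `Δf(z) ≥ |∇f|²(z) - 2c (f(z) - f(x₀)) ≥ 0`. So `f` is again
subharmonic, hence constant, and the traced equation gives `S = mc`.

Hamilton's identity (`derivation_soliton`) combines the contracted Bianchi identity `2 div Rc = dR`,
the formula `div Hess f = dΔf + Rc(∇f)`, the divergence `2 div u^*h = d|∇u|² + 2⟨τu, du⟩` and
`d|∇f|² = 2 Hess f(∇f)`. These are proved by matrix algebra over a commutative ring with commuting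
derivations, where `Γ i` has entry `Γ^k_{ij}` in row `k` and column `j`; the ring is later taken to
be the smooth functions on an open set of coordinates. Since `laplaceBeltrami` is computed at each
point in that point's own chart, `chart_invariance` is needed before any local argument. The maximum
principle is proved in coordinates (`eventually_eq_of_lap_nonpos`) and globalised by connectedness.
-/

namespace RHSoliton

open Matrix

/-! ### Tensor calculus over a commutative ring with commuting derivations -/

section Algebraic

variable {R : Type*} [CommRing R] [Algebra ℝ R] {m n : ℕ}
  (D : Fin m → Derivation ℝ R R)

/-- The entrywise derivative of a matrix. -/
def matD {ι κ : Type*} (i : Fin m) (A : Matrix ι κ R) : Matrix ι κ R := A.map (D i)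

@[simp] lemma matD_apply {ι κ : Type*} (i : Fin m) (A : Matrix ι κ R) (a : ι) (b : κ) :
    matD D i A a b = D i (A a b) := rfl

lemma matD_add {ι κ : Type*} (i : Fin m) (A B : Matrix ι κ R) :
    matD D i (A + B) = matD D i A + matD D i B := by ext; simp

lemma matD_sub {ι κ : Type*} (i : Fin m) (A B : Matrix ι κ R) :
    matD D i (A - B) = matD D i A - matD D i B := by ext; simp

lemma matD_transpose {ι κ : Type*} (i : Fin m) (A : Matrix ι κ R) :
    matD D i Aᵀ = (matD D i A)ᵀ := rfl

lemma matD_mul {ι κ μ : Type*} [Fintype κ] (i : Fin m) (A : Matrix ι κ R) (B : Matrix κ μ R) :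
    matD D i (A * B) = matD D i A * B + A * matD D i B := by
  ext a b
  simp only [matD_apply, mul_apply, map_sum, Derivation.leibniz, smul_eq_mul, Matrix.add_apply,
    ← Finset.sum_add_distrib]
  exact Finset.sum_congr rfl fun _ _ => by ring

lemma matD_comm (hD : ∀ i j a, D i (D j a) = D j (D i a)) {ι κ : Type*} (i j : Fin m)
    (A : Matrix ι κ R) : matD D i (matD D j A) = matD D j (matD D i A) := by
  ext; simp [hD i j]

/-- The curvature matrices of a connection. -/
def curv (Γ : Fin m → Matrix (Fin m) (Fin m) R) (i j : Fin m) : Matrix (Fin m) (Fin m) R :=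
  matD D i (Γ j) - matD D j (Γ i) + Γ i * Γ j - Γ j * Γ i

/-- The Ricci contraction of the curvature. -/
def ric (Γ : Fin m → Matrix (Fin m) (Fin m) R) : Matrix (Fin m) (Fin m) R :=
  Matrix.of fun p b => ∑ k, curv D Γ k b k p

/-- The covariant derivative of a covariant 2-tensor. -/
def cov (Γ : Fin m → Matrix (Fin m) (Fin m) R) (i : Fin m) (T : Matrix (Fin m) (Fin m) R) :
    Matrix (Fin m) (Fin m) R :=
  matD D i T - (Γ i)ᵀ * T - T * Γ i

/-- The covariant derivative of a covector. -/
def covVec (Γ : Fin m → Matrix (Fin m) (Fin m) R) (i : Fin m) (v : Fin m → R) : Fin m → R :=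
  fun j => D i (v j) - ∑ k, v k * Γ i k j

/-- The divergence of a covariant 2-tensor, contracting the first index. -/
def divT (Γ : Fin m → Matrix (Fin m) (Fin m) R) (Gi : Matrix (Fin m) (Fin m) R)
    (T : Matrix (Fin m) (Fin m) R) (c : Fin m) : R :=
  ∑ p, ∑ k, Gi p k * cov D Γ k T p c

/-- The covariant derivative of the curvature. -/
def covCurv (Γ : Fin m → Matrix (Fin m) (Fin m) R) (a b c : Fin m) :
    Matrix (Fin m) (Fin m) R :=
  matD D a (curv D Γ b c) + Γ a * curv D Γ b c - curv D Γ b c * Γ a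
    - ∑ e, Γ a e b • curv D Γ e c - ∑ e, Γ a e c • curv D Γ b e

/-- `Γ` is the Levi-Civita connection of the metric `G` with inverse `Gi`. -/
structure IsLeviCivita (G Gi : Matrix (Fin m) (Fin m) R)
    (Γ : Fin m → Matrix (Fin m) (Fin m) R) : Prop where
  symm : Gᵀ = G
  inv_mul : Gi * G = 1
  torsion : ∀ i j k, Γ i k j = Γ j k i
  compat : ∀ i, matD D i G = (Γ i)ᵀ * G + G * Γ i

variable {D} {G Gi : Matrix (Fin m) (Fin m) R} {Γ : Fin m → Matrix (Fin m) (Fin m) R}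

namespace IsLeviCivita

lemma mul_inv (h : IsLeviCivita D G Gi Γ) : G * Gi = 1 := mul_eq_one_comm.mp h.inv_mul

lemma inv_symm (h : IsLeviCivita D G Gi Γ) : Giᵀ = Gi := by
  have h1 : G * Giᵀ = 1 := by
    have := congrArg transpose h.inv_mul
    rwa [transpose_mul, h.symm, transpose_one] at this
  calc Giᵀ = (Gi * G) * Giᵀ := by rw [h.inv_mul, one_mul]
    _ = Gi := by rw [mul_assoc, h1, mul_one]

lemma inv_symm_apply (h : IsLeviCivita D G Gi Γ) (i j : Fin m) : Gi i j = Gi j i :=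
  congrFun (congrFun h.inv_symm j) i

lemma sum_inv_swap (h : IsLeviCivita D G Gi Γ) (a : Fin m → Fin m → R) :
    ∑ j, ∑ k, Gi j k * a j k = ∑ j, ∑ k, Gi j k * a k j := by
  rw [Finset.sum_comm]
  exact Finset.sum_congr rfl fun k _ => Finset.sum_congr rfl fun j _ => by
    rw [h.inv_symm_apply]

/-- The inverse metric is parallel; this comes from differentiating `Gi * G = 1`. -/
lemma matD_inv (h : IsLeviCivita D G Gi Γ) (i : Fin m) :
    matD D i Gi = - (Γ i * Gi) - Gi * (Γ i)ᵀ := by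
  have h1 : matD D i Gi * G + Gi * matD D i G = 0 := by
    rw [← matD_mul, h.inv_mul]; ext a b
    by_cases hab : a = b <;> simp [hab]
  have h2 : matD D i Gi = - (Gi * matD D i G * Gi) := by
    calc matD D i Gi = (matD D i Gi * G + Gi * matD D i G) * Gi - Gi * matD D i G * Gi := by
          rw [add_mul, mul_assoc (matD D i Gi), h.mul_inv]; simp
      _ = _ := by rw [h1]; simp
  rw [h2, h.compat, mul_add, add_mul]
  have e1 : Gi * ((Γ i)ᵀ * G) * Gi = Gi * (Γ i)ᵀ := by
    rw [mul_assoc, mul_assoc, h.mul_inv, mul_one]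
  have e2 : Gi * (G * Γ i) * Gi = Γ i * Gi := by
    rw [← mul_assoc, h.inv_mul, one_mul]
  rw [e1, e2]; abel

/-- Metric traces commute with covariant differentiation because the inverse metric is parallel. -/
lemma derivation_trace (h : IsLeviCivita D G Gi Γ) (i : Fin m) (T : Matrix (Fin m) (Fin m) R) :
    D i (trace (Gi * T)) = trace (Gi * cov D Γ i T) := by
  have h0 : D i (trace (Gi * T)) = trace (matD D i (Gi * T)) := by simp [trace, matD]
  have h1 : trace (Γ i * Gi * T) = trace (Gi * (T * Γ i)) := by
    rw [mul_assoc, trace_mul_comm, mul_assoc]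
  rw [h0, matD_mul, h.matD_inv, cov, trace_add, sub_mul, trace_sub, neg_mul, trace_neg, h1,
    mul_sub, mul_sub, trace_sub, trace_sub, mul_assoc Gi]
  ring

lemma cov_metric (h : IsLeviCivita D G Gi Γ) (i : Fin m) : cov D Γ i G = 0 := by
  rw [cov, h.compat]; abel

lemma curv_antisymm (i j : Fin m) : curv D Γ i j = - curv D Γ j i := by
  unfold curv; abel

/-- Metric compatibility differentiated twice: the second derivatives of `G` commute, and what
remains of their commutator is exactly the skewness of the curvature endomorphism with respect to
`G`. -/
lemma curv_lower (hD : ∀ i j a, D i (D j a) = D j (D i a)) (h : IsLeviCivita D G Gi Γ)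
    (i j : Fin m) : (curv D Γ i j)ᵀ * G + G * curv D Γ i j = 0 := by
  have h1 := matD_comm D hD i j G
  rw [h.compat, h.compat, matD_add, matD_add, matD_mul, matD_mul, matD_mul, matD_mul,
    h.compat, h.compat, matD_transpose, matD_transpose, ← sub_eq_zero] at h1
  rw [← h1]
  simp only [curv, transpose_sub, transpose_add, transpose_mul, ← matD_transpose]
  noncomm_ring

lemma covCurv_antisymm (a b c : Fin m) : covCurv D Γ a b c = - covCurv D Γ a c b := by
  unfold covCurv
  have e1 : matD D a (curv D Γ b c) = - matD D a (curv D Γ c b) := by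
    rw [curv_antisymm b c]; ext; simp
  have e2 : ∑ e, Γ a e b • curv D Γ e c = - ∑ e, Γ a e b • curv D Γ c e := by
    rw [← Finset.sum_neg_distrib]
    exact Finset.sum_congr rfl fun e _ => by rw [curv_antisymm e c, smul_neg]
  have e3 : ∑ e, Γ a e c • curv D Γ b e = - ∑ e, Γ a e c • curv D Γ e b := by
    rw [← Finset.sum_neg_distrib]
    exact Finset.sum_congr rfl fun e _ => by rw [curv_antisymm b e, smul_neg]
  rw [e1, e2, e3, curv_antisymm b c]
  noncomm_ring

/-- The second Bianchi identity. Second derivatives cancel since the derivations commute, the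
corrections on the two form indices cancel in pairs by vanishing torsion (`key`), and the rest is a
cyclic cancellation of noncommutative products. -/
lemma bianchi (hD : ∀ i j a, D i (D j a) = D j (D i a)) (h : IsLeviCivita D G Gi Γ)
    (a b c : Fin m) : covCurv D Γ a b c + covCurv D Γ b c a + covCurv D Γ c a b = 0 := by
  have key : ∀ a b c : Fin m, ∑ e, Γ a e c • curv D Γ b e = - ∑ e, Γ c e a • curv D Γ e b := by
    intro a b c
    rw [← Finset.sum_neg_distrib]
    exact Finset.sum_congr rfl fun e _ => by
      rw [curv_antisymm b e, smul_neg, h.torsion a c e]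
  unfold covCurv
  rw [key a b c, key b c a, key c a b]
  have e : ∀ a b c : Fin m, matD D a (curv D Γ b c) =
      matD D a (matD D b (Γ c)) - matD D a (matD D c (Γ b)) +
      (matD D a (Γ b) * Γ c + Γ b * matD D a (Γ c)) -
      (matD D a (Γ c) * Γ b + Γ c * matD D a (Γ b)) := by
    intro a b c
    rw [curv, matD_sub, matD_add, matD_sub, matD_mul, matD_mul]
  have c1 : ∀ b c : Fin m, curv D Γ b c = matD D b (Γ c) - matD D c (Γ b) + Γ b * Γ c - Γ c * Γ b :=
    fun _ _ => rfl
  rw [e a b c, e b c a, e c a b, matD_comm D hD b a, matD_comm D hD c a, matD_comm D hD c b]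
  generalize ∑ e, Γ a e b • curv D Γ e c = s1
  generalize ∑ e, Γ b e c • curv D Γ e a = s2
  generalize ∑ e, Γ c e a • curv D Γ e b = s3
  rw [c1 b c, c1 c a, c1 a b]
  noncomm_ring

/-- Skewness survives covariant differentiation because the metric is parallel. -/
lemma covCurv_lower (hD : ∀ i j a, D i (D j a) = D j (D i a)) (h : IsLeviCivita D G Gi Γ)
    (a b c : Fin m) : (covCurv D Γ a b c)ᵀ * G + G * covCurv D Γ a b c = 0 := by
  have h1 : matD D a ((curv D Γ b c)ᵀ * G + G * curv D Γ b c) = 0 := by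
    rw [h.curv_lower hD]; ext; simp
  rw [matD_add, matD_mul, matD_mul, h.compat, matD_transpose] at h1
  have key : ∀ (w : Fin m → R) (F : Fin m → Matrix (Fin m) (Fin m) R),
      (∀ e, (F e)ᵀ * G + G * F e = 0) →
      (∑ e, w e • F e)ᵀ * G + G * (∑ e, w e • F e) = 0 := by
    intro w F hF
    rw [transpose_sum, Finset.sum_mul, Finset.mul_sum, ← Finset.sum_add_distrib]
    refine Finset.sum_eq_zero fun e _ => ?_
    rw [transpose_smul, smul_mul_assoc, mul_smul_comm, ← smul_add, hF, smul_zero]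
  have k1 := key (fun e => Γ a e b) (fun e => curv D Γ e c) fun e => h.curv_lower hD e c
  have k2 := key (fun e => Γ a e c) (fun e => curv D Γ b e) fun e => h.curv_lower hD b e
  have h2 := h.curv_lower hD b c
  have h2' : G * curv D Γ b c = - ((curv D Γ b c)ᵀ * G) := by
    rw [eq_neg_iff_add_eq_zero, add_comm]; exact h2
  unfold covCurv
  simp only [transpose_sub, transpose_add, transpose_mul]
  generalize ∑ e, Γ a e b • curv D Γ e c = s1 at *
  generalize ∑ e, Γ a e c • curv D Γ b e = s2 at *
  generalize curv D Γ b c = F at *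
  have : ((matD D a F)ᵀ + Fᵀ * (Γ a)ᵀ - (Γ a)ᵀ * Fᵀ - s1ᵀ - s2ᵀ) * G +
      G * (matD D a F + Γ a * F - F * Γ a - s1 - s2)
      = ((matD D a F)ᵀ * G + Fᵀ * ((Γ a)ᵀ * G + G * Γ a) +
          (((Γ a)ᵀ * G + G * Γ a) * F + G * matD D a F))
        - (s1ᵀ * G + G * s1) - (s2ᵀ * G + G * s2)
        - (Γ a)ᵀ * (Fᵀ * G + G * F) - (Fᵀ * G + G * F) * Γ a := by noncomm_ring
  rw [this, h1, k1, k2, h2]; simp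

/-- Raising the lower matrix index of the derivative of the curvature gives an antisymmetric
matrix. -/
lemma antisymm_raise (h : IsLeviCivita D G Gi Γ) {N : Matrix (Fin m) (Fin m) R}
    (hN : Nᵀ * G + G * N = 0) (i j : Fin m) : (N * Gi) i j = - (N * Gi) j i := by
  have h1 : N * Gi = - (N * Gi)ᵀ := by
    rw [transpose_mul, h.inv_symm, eq_neg_iff_add_eq_zero]
    calc N * Gi + Gi * Nᵀ = Gi * (Nᵀ * G + G * N) * Gi := by
          rw [mul_add, add_mul, ← mul_assoc Gi G, h.inv_mul, one_mul, mul_assoc Gi,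
            mul_assoc Nᵀ, h.mul_inv, mul_one, add_comm]
      _ = 0 := by rw [hN]; simp
  exact congrFun (congrFun h1 i) j

/-- Contracting an upper with a lower index commutes with the covariant derivative: the two
connection terms on the contracted index cancel. -/
lemma cov_ric (c p b : Fin m) :
    cov D Γ c (ric D Γ) p b = ∑ k, covCurv D Γ c k b k p := by
  simp only [cov, covCurv, ric, Matrix.sub_apply, Matrix.add_apply, matD_apply, of_apply,
    mul_apply, transpose_apply, Matrix.sum_apply, Matrix.smul_apply, smul_eq_mul, map_sum, Finset.sum_sub_distrib,
    Finset.sum_add_distrib, Finset.mul_sum, Finset.sum_mul]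
  have e2 : ∑ k, ∑ x, Γ c k x * curv D Γ k b x p = ∑ k, ∑ x, Γ c x k * curv D Γ x b k p := by
    rw [Finset.sum_comm]
  have e3 : ∑ x, ∑ k, Γ c x p * curv D Γ k b k x = ∑ k, ∑ x, curv D Γ k b k x * Γ c x p := by
    rw [Finset.sum_comm]
    exact Finset.sum_congr rfl fun k _ => Finset.sum_congr rfl fun x _ => mul_comm _ _
  have e4 : ∑ x, ∑ k, curv D Γ k x k p * Γ c x b = ∑ k, ∑ x, Γ c x b * curv D Γ k x k p := by
    rw [Finset.sum_comm]
    exact Finset.sum_congr rfl fun k _ => Finset.sum_congr rfl fun x _ => mul_comm _ _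
  rw [e2, e3, e4]; ring

/-- The contracted second Bianchi identity. -/
lemma two_mul_divT_ric (hD : ∀ i j a, D i (D j a) = D j (D i a)) (h : IsLeviCivita D G Gi Γ)
    (c : Fin m) : 2 * divT D Γ Gi (ric D Γ) c = D c (trace (Gi * ric D Γ)) := by
  have h3 : D c (trace (Gi * ric D Γ)) = ∑ p, ∑ b, ∑ k, Gi p b * covCurv D Γ c k b k p := by
    rw [h.derivation_trace, trace]
    simp only [diag_apply, mul_apply, cov_ric, Finset.mul_sum]
    rw [Finset.sum_comm]
    refine Finset.sum_congr rfl fun p _ => Finset.sum_congr rfl fun b _ => ?_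
    refine Finset.sum_congr rfl fun k _ => ?_
    rw [h.inv_symm_apply]
  -- Of the three cyclic Bianchi terms, contracted twice, two equal minus the divergence of Ricci
  -- and one is the derivative of the scalar curvature. This first one needs skewness in the
  -- endomorphism indices.
  have h1 : divT D Γ Gi (ric D Γ) c = - ∑ p, ∑ b, ∑ k, Gi p b * covCurv D Γ k b c k p := by
    have A : divT D Γ Gi (ric D Γ) c = ∑ k, ∑ j, (covCurv D Γ k j c * Gi) j k := by
      simp only [divT, cov_ric, Finset.mul_sum, mul_apply]
      rw [Finset.sum_comm]
      refine Finset.sum_congr rfl fun k _ => ?_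
      rw [Finset.sum_comm]
      exact Finset.sum_congr rfl fun j _ => Finset.sum_congr rfl fun p _ => mul_comm _ _
    have B : ∑ p, ∑ b, ∑ k, Gi p b * covCurv D Γ k b c k p
        = ∑ k, ∑ j, (covCurv D Γ k j c * Gi) k j := by
      simp only [mul_apply]
      rw [Finset.sum_comm, Finset.sum_comm (s := Finset.univ (α := Fin m))
        (f := fun k j => ∑ p, covCurv D Γ k j c k p * Gi p j)]
      refine Finset.sum_congr rfl fun j _ => ?_
      rw [Finset.sum_comm]
      exact Finset.sum_congr rfl fun k _ => Finset.sum_congr rfl fun p _ => mul_comm _ _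
    rw [A, B, ← Finset.sum_neg_distrib]
    refine Finset.sum_congr rfl fun k _ => ?_
    rw [← Finset.sum_neg_distrib]
    exact Finset.sum_congr rfl fun j _ =>
      h.antisymm_raise (h.covCurv_lower hD k j c) j k
  -- The second term only needs skewness in the form indices.
  have h2 : divT D Γ Gi (ric D Γ) c = - ∑ p, ∑ b, ∑ k, Gi p b * covCurv D Γ b c k k p := by
    simp only [divT, cov_ric, Finset.mul_sum, ← Finset.sum_neg_distrib]
    refine Finset.sum_congr rfl fun p _ => Finset.sum_congr rfl fun b _ => ?_
    refine Finset.sum_congr rfl fun k _ => ?_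
    rw [covCurv_antisymm b c k]; simp
  have h4 : ∑ p, ∑ b, ∑ k, Gi p b * covCurv D Γ k b c k p
      + ∑ p, ∑ b, ∑ k, Gi p b * covCurv D Γ b c k k p
      + ∑ p, ∑ b, ∑ k, Gi p b * covCurv D Γ c k b k p = 0 := by
    simp only [← Finset.sum_add_distrib, ← mul_add]
    refine Finset.sum_eq_zero fun p _ => Finset.sum_eq_zero fun b _ =>
      Finset.sum_eq_zero fun k _ => ?_
    have := congrFun (congrFun (h.bianchi hD k b c) k) p
    simp only [Matrix.add_apply, Matrix.zero_apply] at this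
    rw [this, mul_zero]
  rw [h3]
  linear_combination h1 + h2 - h4

end IsLeviCivita

end Algebraic

end RHSoliton

/-! ### Hessians, pullback metrics and Hamilton's identity, algebraically -/

namespace RHSoliton

open Matrix

section Algebraic

variable {R : Type*} [CommRing R] [Algebra ℝ R] {m n : ℕ}
  {D : Fin m → Derivation ℝ R R}
  {G Gi : Matrix (Fin m) (Fin m) R} {Γ : Fin m → Matrix (Fin m) (Fin m) R}

variable (D Γ) in
/-- The Hessian of a function. -/
def hessM (f : R) : Matrix (Fin m) (Fin m) R := Matrix.of fun i j => covVec D Γ i (fun l => D l f) j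

/-- The squared norm of the gradient. -/
def gradSq (D : Fin m → Derivation ℝ R R) (Gi : Matrix (Fin m) (Fin m) R) (f : R) : R :=
  trace (Gi * vecMulVec (fun l => D l f) (fun l => D l f))

lemma cov_add (i : Fin m) (S T : Matrix (Fin m) (Fin m) R) :
    cov D Γ i (S + T) = cov D Γ i S + cov D Γ i T := by
  unfold cov; rw [matD_add]; noncomm_ring

lemma cov_sub (i : Fin m) (S T : Matrix (Fin m) (Fin m) R) :
    cov D Γ i (S - T) = cov D Γ i S - cov D Γ i T := by
  unfold cov; rw [matD_sub]; noncomm_ring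

lemma cov_smul (i : Fin m) (a : R) (T : Matrix (Fin m) (Fin m) R) :
    cov D Γ i (a • T) = D i a • T + a • cov D Γ i T := by
  unfold cov
  have : matD D i (a • T) = D i a • T + a • matD D i T := by
    ext; simp; ring
  rw [this, mul_smul_comm, smul_mul_assoc]; simp only [smul_sub]; abel

lemma cov_transpose (i : Fin m) (T : Matrix (Fin m) (Fin m) R) :
    cov D Γ i Tᵀ = (cov D Γ i T)ᵀ := by
  unfold cov
  rw [matD_transpose, transpose_sub, transpose_sub, transpose_mul, transpose_mul,
    transpose_transpose]
  abel

lemma cov_sum {ι : Type*} (s : Finset ι) (i : Fin m) (T : ι → Matrix (Fin m) (Fin m) R) :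
    cov D Γ i (∑ e ∈ s, T e) = ∑ e ∈ s, cov D Γ i (T e) := by
  classical
  induction s using Finset.induction_on with
  | empty => ext; simp [cov]
  | insert a s ha ih => rw [Finset.sum_insert ha, Finset.sum_insert ha, cov_add, ih]

lemma cov_vecMulVec (i : Fin m) (v w : Fin m → R) :
    cov D Γ i (vecMulVec v w) =
      vecMulVec (covVec D Γ i v) w + vecMulVec v (covVec D Γ i w) := by
  ext a b
  simp only [cov, covVec, Matrix.sub_apply, Matrix.add_apply, vecMulVec_apply, matD_apply,
    mul_apply, transpose_apply, Derivation.leibniz, smul_eq_mul, sub_mul, mul_sub,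
    Finset.sum_mul, Finset.mul_sum]
  have e1 : ∑ x, Γ i x a * (v x * w b) = ∑ x, v x * Γ i x a * w b :=
    Finset.sum_congr rfl fun x _ => by ring
  have e2 : ∑ x, v a * w x * Γ i x b = ∑ x, v a * (w x * Γ i x b) :=
    Finset.sum_congr rfl fun x _ => by ring
  rw [e1, e2]; ring

lemma divT_add (S T : Matrix (Fin m) (Fin m) R) (c : Fin m) :
    divT D Γ Gi (S + T) c = divT D Γ Gi S c + divT D Γ Gi T c := by
  simp only [divT, cov_add, Matrix.add_apply, mul_add, Finset.sum_add_distrib]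

lemma divT_sub (S T : Matrix (Fin m) (Fin m) R) (c : Fin m) :
    divT D Γ Gi (S - T) c = divT D Γ Gi S c - divT D Γ Gi T c := by
  simp only [divT, cov_sub, Matrix.sub_apply, mul_sub, Finset.sum_sub_distrib]

lemma divT_smul (a : ℝ) (T : Matrix (Fin m) (Fin m) R) (c : Fin m) :
    divT D Γ Gi (algebraMap ℝ R a • T) c = algebraMap ℝ R a * divT D Γ Gi T c := by
  simp only [divT, cov_smul, Derivation.map_algebraMap, zero_smul, zero_add, Matrix.smul_apply,
    smul_eq_mul, Finset.mul_sum]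
  exact Finset.sum_congr rfl fun x _ => Finset.sum_congr rfl fun y _ => by ring

namespace IsLeviCivita

lemma hessM_symm (hD : ∀ i j a, D i (D j a) = D j (D i a)) (h : IsLeviCivita D G Gi Γ) (f : R)
    (i j : Fin m) : hessM D Γ f i j = hessM D Γ f j i := by
  simp only [hessM, of_apply, covVec, hD i j, h.torsion i j]

/-- The Ricci identity for the differential of a function. -/
lemma cov_hessM_sub (hD : ∀ i j a, D i (D j a) = D j (D i a)) (h : IsLeviCivita D G Gi Γ)
    (f : R) (k i j : Fin m) :
    cov D Γ k (hessM D Γ f) i j - cov D Γ i (hessM D Γ f) k j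
      = - ∑ l, D l f * curv D Γ k i l j := by
  -- With the differential as a one-row matrix, covariant differentiation reads `V ↦ D V - V Γ`, and
  -- the commutator of two such operators is minus right multiplication by the curvature. The
  -- connection term on the other Hessian index drops out by vanishing torsion.
  set V : Matrix Unit (Fin m) R := Matrix.of fun _ l => D l f with hV
  have hH : ∀ i j, hessM D Γ f i j = (matD D i V - V * Γ i) () j := by
    intro i j; simp [hessM, covVec, hV, mul_apply]
  have h1 : ∀ k i j, cov D Γ k (hessM D Γ f) i j =
      (matD D k (matD D i V - V * Γ i) - (matD D i V - V * Γ i) * Γ k) () j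
        - ∑ l, Γ k l i * hessM D Γ f l j := by
    intro k i j
    simp only [cov, Matrix.sub_apply (matD D k (hessM D Γ f) - _), Matrix.sub_apply (matD D k _),
      mul_apply, transpose_apply, hH, matD_apply]
    ring
  have h2 : ∑ l, D l f * curv D Γ k i l j = (V * curv D Γ k i) () j := by
    simp [mul_apply, hV]
  rw [h1, h1, h2, Finset.sum_congr rfl fun l _ => by rw [h.torsion k i l]]
  have h3 : matD D k (matD D i V - V * Γ i) - (matD D i V - V * Γ i) * Γ k
      - (matD D i (matD D k V - V * Γ k) - (matD D k V - V * Γ k) * Γ i)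
      = - (V * curv D Γ k i) := by
    simp only [matD_sub, matD_mul, matD_comm D hD k i, curv, Matrix.mul_sub, Matrix.mul_add,
      Matrix.sub_mul, Matrix.mul_assoc]
    abel
  have h4 := congrFun (congrFun h3 ()) j
  simp only [Matrix.sub_apply, Matrix.neg_apply] at h4 ⊢
  linear_combination h4

/-- The divergence of the Hessian of a function. -/
lemma divT_hessM (hD : ∀ i j a, D i (D j a) = D j (D i a)) (h : IsLeviCivita D G Gi Γ)
    (f : R) (c : Fin m) :
    divT D Γ Gi (hessM D Γ f) c = D c (trace (Gi * hessM D Γ f))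
      + ∑ j, ∑ l, Gi j l * (ric D Γ j c * D l f) := by
  have hsym : ∀ k i j, cov D Γ k (hessM D Γ f) i j = cov D Γ k (hessM D Γ f) j i := by
    intro k i j
    have hT : (hessM D Γ f)ᵀ = hessM D Γ f := by ext a b; exact h.hessM_symm hD f b a
    conv_lhs => rw [← hT, cov_transpose]
    rfl
  have h1 : divT D Γ Gi (hessM D Γ f) c - D c (trace (Gi * hessM D Γ f))
      = ∑ j, ∑ k, Gi j k * - ∑ l, D l f * curv D Γ k c l j := by
    rw [h.derivation_trace, divT, trace]
    simp only [diag_apply, mul_apply, ← Finset.sum_sub_distrib]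
    refine Finset.sum_congr rfl fun j _ => Finset.sum_congr rfl fun k _ => ?_
    rw [← h.cov_hessM_sub hD, hsym k j c, mul_sub]
  have h2 : ∑ j, ∑ k, Gi j k * - ∑ l, D l f * curv D Γ k c l j
      = ∑ k, ∑ l, - (D l f * (curv D Γ k c * Gi) l k) := by
    rw [Finset.sum_comm]
    refine Finset.sum_congr rfl fun k _ => ?_
    simp only [mul_apply, Finset.mul_sum, ← Finset.sum_neg_distrib]
    rw [Finset.sum_comm]
    exact Finset.sum_congr rfl fun l _ => Finset.sum_congr rfl fun j _ => by ring
  -- Skewness of the curvature with raised index turns this contraction into the one defining Ricci.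
  have h3 : ∑ k, ∑ l, - (D l f * (curv D Γ k c * Gi) l k)
      = ∑ j, ∑ l, Gi j l * (ric D Γ j c * D l f) := by
    have : ∀ k l, - (D l f * (curv D Γ k c * Gi) l k) =
        ∑ j, Gi j l * (curv D Γ k c k j * D l f) := by
      intro k l
      rw [h.antisymm_raise (h.curv_lower hD k c), mul_apply, mul_neg, neg_neg, Finset.mul_sum]
      exact Finset.sum_congr rfl fun j _ => by ring
    simp only [this, ric, of_apply, Finset.sum_mul, Finset.mul_sum]
    rw [Finset.sum_comm, Finset.sum_comm (s := Finset.univ (α := Fin m))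
      (f := fun j l => ∑ k, Gi j l * (curv D Γ k c k j * D l f))]
    refine Finset.sum_congr rfl fun l _ => ?_
    rw [Finset.sum_comm]
  rw [← h3, ← h2, ← h1]; ring

lemma derivation_gradSq (h : IsLeviCivita D G Gi Γ) (f : R) (c : Fin m) :
    D c (gradSq D Gi f) = 2 * ∑ j, ∑ l, Gi j l * (hessM D Γ f c j * D l f) := by
  rw [gradSq, h.derivation_trace, cov_vecMulVec, mul_add, trace_add, two_mul]
  simp only [trace, diag_apply, mul_apply, vecMulVec_apply]
  congr 1
  · rw [h.sum_inv_swap]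
    rfl
  · exact Finset.sum_congr rfl fun j _ => Finset.sum_congr rfl fun l _ => by
      rw [hessM, of_apply, mul_comm (D l f)]

variable (D) in
/-- The pullback of a metric `H` of the target by a map with components `U`. -/
def _root_.RHSoliton.pullM (H : Matrix (Fin n) (Fin n) R) (U : Fin n → R) :
    Matrix (Fin m) (Fin m) R :=
  ∑ a, ∑ b, H a b • vecMulVec (fun l => D l (U a)) (fun l => D l (U b))

lemma _root_.RHSoliton.pullM_symm {H : Matrix (Fin n) (Fin n) R} (hH : Hᵀ = H) (U : Fin n → R)
    (i j : Fin m) : pullM D H U i j = pullM D H U j i := by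
  simp only [pullM, Matrix.sum_apply, Matrix.smul_apply, vecMulVec_apply, smul_eq_mul]
  rw [Finset.sum_comm]
  exact Finset.sum_congr rfl fun a _ => Finset.sum_congr rfl fun b _ => by
    rw [show H b a = H a b from congrFun (congrFun hH a) b]; ring

lemma _root_.RHSoliton.sum_contract_swap (H : Matrix (Fin n) (Fin n) R) (x : Fin n → R)
    (K : Matrix (Fin m) (Fin m) R) (t : Fin m → Fin m → Fin n → R) :
    ∑ a, ∑ b, H a b * x a * (∑ j, ∑ k, K j k * t j k b) =
      ∑ j, ∑ k, K j k * ∑ a, ∑ b, H a b * (x a * t j k b) := by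
  simp only [Finset.mul_sum]
  have e1 : ∀ a, ∑ b, ∑ j, ∑ k, H a b * x a * (K j k * t j k b)
      = ∑ j, ∑ k, ∑ b, H a b * x a * (K j k * t j k b) := by
    intro a
    rw [Finset.sum_comm]
    exact Finset.sum_congr rfl fun j _ => Finset.sum_comm
  rw [Finset.sum_congr rfl fun a _ => e1 a, Finset.sum_comm]
  refine Finset.sum_congr rfl fun j _ => ?_
  rw [Finset.sum_comm]
  exact Finset.sum_congr rfl fun k _ => Finset.sum_congr rfl fun a _ =>
    Finset.sum_congr rfl fun b _ => by ring

/-- No target connection enters here: derivatives of `H` along the map stay explicit, and only the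
target Koszul formula in `divT_pullM` converts them into the Christoffel term of the tension field.
-/
lemma cov_pullM (H : Matrix (Fin n) (Fin n) R) (U : Fin n → R) (k i j : Fin m) :
    cov D Γ k (pullM D H U) i j = ∑ a, ∑ b, D k (H a b) * (D i (U a) * D j (U b))
      + (∑ a, ∑ b, H a b * (hessM D Γ (U a) k i * D j (U b))
      + ∑ a, ∑ b, H a b * (D i (U a) * hessM D Γ (U b) k j)) := by
  simp only [pullM, cov_sum, cov_smul, cov_vecMulVec, Matrix.sum_apply, Matrix.add_apply,
    Matrix.smul_apply, vecMulVec_apply, smul_eq_mul, ← Finset.sum_add_distrib, hessM, of_apply]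
  exact Finset.sum_congr rfl fun j _ => Finset.sum_congr rfl fun l _ => by ring

/-- The divergence of the pullback metric in terms of the tension field. -/
lemma divT_pullM (hD : ∀ i j a, D i (D j a) = D j (D i a)) (h : IsLeviCivita D G Gi Γ)
    {H : Matrix (Fin n) (Fin n) R} (hH : Hᵀ = H) {U : Fin n → R}
    {dH : Fin n → Matrix (Fin n) (Fin n) R} {ΓH : Fin n → Fin n → Fin n → R}
    (hdH : ∀ i a b, D i (H a b) = ∑ e, dH e a b * D i (U e))
    (hΓ : ∀ a d e, 2 * ∑ b, H a b * ΓH b d e = dH d e a + dH e d a - dH a d e) (c : Fin m) :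
    2 * divT D Γ Gi (pullM D H U) c = D c (trace (Gi * pullM D H U)) +
      2 * ∑ a, ∑ b, H a b * D c (U a) * (∑ j, ∑ k, Gi j k * (hessM D Γ (U b) j k +
        ∑ d, ∑ e, ΓH b d e * D j (U d) * D k (U e))) := by
  have hHs : ∀ a b, H a b = H b a := fun a b => congrFun (congrFun hH b) a
  let Q : Fin m → Fin m → Fin m → R := fun k i j =>
    ∑ a, ∑ b, D k (H a b) * (D i (U a) * D j (U b))
  let B : (Fin n → R) → (Fin n → R) → R := fun x y => ∑ a, ∑ b, H a b * (x a * y b)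
  have hB : ∀ x y, B x y = B y x := by
    intro x y
    simp only [B]
    rw [Finset.sum_comm]
    exact Finset.sum_congr rfl fun j _ => Finset.sum_congr rfl fun l _ => by
      rw [hHs l j]; ring
  have hQ : ∀ k i j, Q k i j = Q k j i := by
    intro k x y
    simp only [Q]
    rw [Finset.sum_comm]
    exact Finset.sum_congr rfl fun j _ => Finset.sum_congr rfl fun l _ => by
      rw [hHs l j]; ring
  have hQ3 : ∀ k i j, Q k i j = ∑ e, ∑ a, ∑ b, dH e a b * (D k (U e) * D i (U a) * D j (U b)) := by
    intro k i j
    simp only [Q, hdH, Finset.sum_mul]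
    symm
    rw [Finset.sum_comm]
    refine Finset.sum_congr rfl fun a _ => ?_
    rw [Finset.sum_comm]
    exact Finset.sum_congr rfl fun b _ => Finset.sum_congr rfl fun e _ => by ring
  let dU : Fin m → Fin n → R := fun i a => D i (U a)
  let hU : Fin m → Fin m → Fin n → R := fun i j a => hessM D Γ (U a) i j
  have hUs : ∀ i j, hU i j = hU j i := fun i j => funext fun a => h.hessM_symm hD (U a) i j
  have hcov : ∀ k i j, cov D Γ k (pullM D H U) i j =
      Q k i j + (B (hU k i) (dU j) + B (dU i) (hU k j)) := fun k i j => cov_pullM H U k i j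
  -- The target Koszul formula `hΓ`, contracted with three differentials of `U`; by the chain rule
  -- `hdH` every term becomes a value of `Q`.
  have hY : ∀ j k, 2 * ∑ a, ∑ b, H a b * D c (U a) *
      ∑ d, ∑ e, ΓH b d e * D j (U d) * D k (U e) = Q j k c + Q k j c - Q c j k := by
    intro j k
    have e1 : Q j k c = ∑ a, ∑ d, ∑ e, dH d e a * (D c (U a) * D j (U d) * D k (U e)) := by
      rw [hQ3]
      conv_rhs => rw [Finset.sum_comm]
      refine Finset.sum_congr rfl fun d _ => ?_
      rw [Finset.sum_comm]
      exact Finset.sum_congr rfl fun a _ => Finset.sum_congr rfl fun e _ => by ring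
    have e2 : Q k j c = ∑ a, ∑ d, ∑ e, dH e d a * (D c (U a) * D j (U d) * D k (U e)) := by
      have : ∀ a, ∑ d, ∑ e, dH e d a * (D c (U a) * D j (U d) * D k (U e))
          = ∑ e, ∑ d, dH e d a * (D c (U a) * D j (U d) * D k (U e)) :=
        fun a => Finset.sum_comm
      rw [hQ3, Finset.sum_congr rfl fun a _ => this a]
      conv_rhs => rw [Finset.sum_comm]
      refine Finset.sum_congr rfl fun e _ => ?_
      rw [Finset.sum_comm]
      exact Finset.sum_congr rfl fun a _ => Finset.sum_congr rfl fun d _ => by ring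
    have e3 : Q c j k = ∑ a, ∑ d, ∑ e, dH a d e * (D c (U a) * D j (U d) * D k (U e)) := hQ3 c j k
    rw [e1, e2, e3]
    simp only [← Finset.sum_add_distrib, ← Finset.sum_sub_distrib, ← add_mul, ← sub_mul, ← hΓ]
    rw [Finset.mul_sum]
    refine Finset.sum_congr rfl fun a _ => ?_
    simp only [Finset.mul_sum, Finset.sum_mul]
    rw [Finset.sum_comm]
    refine Finset.sum_congr rfl fun d _ => ?_
    rw [Finset.sum_comm]
    exact Finset.sum_congr rfl fun b _ => Finset.sum_congr rfl fun e _ => by ring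
  have hR : 2 * ∑ a, ∑ b, H a b * D c (U a) * (∑ j, ∑ k, Gi j k * (hessM D Γ (U b) j k +
        ∑ d, ∑ e, ΓH b d e * D j (U d) * D k (U e))) =
      ∑ j, ∑ k, Gi j k * (2 * B (dU c) (hU j k) + (Q j k c + Q k j c - Q c j k)) := by
    rw [sum_contract_swap H (fun a => D c (U a)) Gi, Finset.mul_sum]
    refine Finset.sum_congr rfl fun j _ => ?_
    rw [Finset.mul_sum]
    refine Finset.sum_congr rfl fun k _ => ?_
    rw [← hY]
    simp only [mul_add, Finset.sum_add_distrib, B, dU, hU, mul_assoc]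
    ring
  have hL : 2 * divT D Γ Gi (pullM D H U) c =
      ∑ p, ∑ k, Gi p k * (2 * (Q k p c + (B (hU k p) (dU c) + B (dU p) (hU k c)))) := by
    simp only [divT, hcov, Finset.mul_sum]
    exact Finset.sum_congr rfl fun j _ => Finset.sum_congr rfl fun l _ => by ring
  have hT : D c (trace (Gi * pullM D H U)) =
      ∑ p, ∑ k, Gi p k * (Q c k p + (B (hU c k) (dU p) + B (dU k) (hU c p))) := by
    rw [h.derivation_trace, trace]
    simp only [diag_apply, mul_apply, hcov]
  -- The summands agree only up to exchanging `p` and `k` in these terms, so the vanishing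
  -- difference supplied by the symmetry of `Gi` is inserted before comparing termwise.
  have hW := h.sum_inv_swap fun p k => Q k p c + B (dU p) (hU k c)
  rw [hL, hT, hR, ← sub_eq_zero, ← sub_eq_zero.mpr hW]
  simp only [← Finset.sum_add_distrib, ← Finset.sum_sub_distrib, ← mul_add, ← mul_sub]
  refine Finset.sum_congr rfl fun p _ => Finset.sum_congr rfl fun k _ => ?_
  rw [hB (hU k p), hB (hU c k), hUs c k, hUs c p, hUs p k, hQ c k p]
  ring

/-- For a gradient soliton with constant `σ = c`, the function `Δ f - |∇ f|² + 2 c f` has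
vanishing derivatives. -/
theorem derivation_soliton (hD : ∀ i j a, D i (D j a) = D j (D i a))
    (h : IsLeviCivita D G Gi Γ) {H : Matrix (Fin n) (Fin n) R} (hH : Hᵀ = H) {U : Fin n → R}
    {dH : Fin n → Matrix (Fin n) (Fin n) R} {ΓH : Fin n → Fin n → Fin n → R}
    (hdH : ∀ i a b, D i (H a b) = ∑ e, dH e a b * D i (U e))
    (hΓ : ∀ a d e, 2 * ∑ b, H a b * ΓH b d e = dH d e a + dH e d a - dH a d e)
    {α c : ℝ} {f : R}
    (hric : ∀ i j, ric D Γ i j - algebraMap ℝ R α * pullM D H U i j + hessM D Γ f i j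
      = algebraMap ℝ R c * G i j)
    (hten : ∀ b, ∑ j, ∑ k, Gi j k * (hessM D Γ (U b) j k +
        ∑ d, ∑ e, ΓH b d e * D j (U d) * D k (U e)) = ∑ j, ∑ k, Gi j k * D j (U b) * D k f)
    (i : Fin m) :
    D i (trace (Gi * hessM D Γ f) - gradSq D Gi f + 2 * algebraMap ℝ R c * f) = 0 := by
  have hr : ric D Γ = algebraMap ℝ R α • pullM D H U - hessM D Γ f + algebraMap ℝ R c • G := by
    ext a b
    simp only [Matrix.add_apply, Matrix.sub_apply, Matrix.smul_apply, smul_eq_mul]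
    linear_combination hric a b
  have h1 := h.two_mul_divT_ric hD i
  have h2 := h.divT_hessM hD f i
  have h3 := h.divT_pullM hD hH hdH hΓ i
  have h4 := h.derivation_gradSq f i
  have hG : divT D Γ Gi G i = 0 := by simp [divT, h.cov_metric]
  have htG : D i (trace (Gi * G)) = 0 := by rw [h.inv_mul]; simp
  have h5 : divT D Γ Gi (ric D Γ) i
      = algebraMap ℝ R α * divT D Γ Gi (pullM D H U) i - divT D Γ Gi (hessM D Γ f) i := by
    rw [hr, divT_add, divT_sub, divT_smul, divT_smul, hG]; ring
  have h6 : D i (trace (Gi * ric D Γ)) = algebraMap ℝ R α * D i (trace (Gi * pullM D H U))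
      - D i (trace (Gi * hessM D Γ f)) := by
    rw [hr, mul_add, mul_sub, trace_add, trace_sub, mul_smul_comm, mul_smul_comm, trace_smul,
      trace_smul, map_add, map_sub, smul_eq_mul, smul_eq_mul, Derivation.leibniz,
      Derivation.leibniz, htG]
    simp
  -- The tension equation turns `⟨τu, du⟩` into `u^*h(∇f)`.
  have h7 : ∑ a, ∑ b, H a b * D i (U a) * (∑ j, ∑ k, Gi j k * (hessM D Γ (U b) j k +
        ∑ d, ∑ e, ΓH b d e * D j (U d) * D k (U e)))
      = ∑ j, ∑ k, Gi j k * (pullM D H U i j * D k f) := by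
    simp only [hten, mul_assoc (Gi _ _)]
    rw [sum_contract_swap H (fun a => D i (U a)) Gi fun j k b => D j (U b) * D k f]
    simp only [pullM, Matrix.sum_apply, Matrix.smul_apply, vecMulVec_apply, smul_eq_mul,
      Finset.sum_mul, mul_assoc]
  have h8 : ∑ j, ∑ k, Gi j k * (G i j * D k f) = D i f := by
    have : ∀ k, ∑ j, Gi j k * (G i j * D k f) = (G * Gi) i k * D k f := by
      intro k
      rw [mul_apply, Finset.sum_mul]
      exact Finset.sum_congr rfl fun j _ => by ring
    rw [Finset.sum_comm, Finset.sum_congr rfl fun k _ => this k, h.mul_inv]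
    simp [Matrix.one_apply]
  have h9 : ∑ j, ∑ l, Gi j l * (ric D Γ j i * D l f)
      = algebraMap ℝ R α * ∑ j, ∑ k, Gi j k * (pullM D H U i j * D k f)
        - ∑ j, ∑ l, Gi j l * (hessM D Γ f i j * D l f)
        + algebraMap ℝ R c * D i f := by
    rw [← h8]
    simp only [Finset.mul_sum, ← Finset.sum_add_distrib, ← Finset.sum_sub_distrib]
    refine Finset.sum_congr rfl fun j _ => Finset.sum_congr rfl fun l _ => ?_
    have e1 : G i j = G j i := congrFun (congrFun h.symm j) i
    rw [h.hessM_symm hD f i j, pullM_symm hH U i j, e1, hr]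
    simp only [Matrix.add_apply, Matrix.sub_apply, Matrix.smul_apply, smul_eq_mul]
    ring
  rw [h7] at h3
  have h10 : D i (2 * algebraMap ℝ R c * f) = 2 * algebraMap ℝ R c * D i f := by
    rw [← map_ofNat (algebraMap ℝ R) 2, ← map_mul, Derivation.leibniz]; simp
  rw [map_add, map_sub, h10, h4]
  -- The divergence formulas leave `dΔf = 2α u^*h(∇f) - 2 Rc(∇f)`, and by the soliton equation the
  -- right side is `2 Hess f(∇f) - 2c df = d|∇f|² - 2c df`.
  linear_combination 2 * h5 - h1 - h6 - 2 * h2 + algebraMap ℝ R α * h3 - 2 * h9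

end IsLeviCivita

end Algebraic

end RHSoliton

/-! ### Uniqueness of the Levi-Civita connection and changes of coordinates -/

namespace RHSoliton

open Matrix

section Algebraic

variable {R : Type*} [CommRing R] [Algebra ℝ R] {m : ℕ}
  {D : Fin m → Derivation ℝ R R}
  {G Gi : Matrix (Fin m) (Fin m) R} {Γ Γ' : Fin m → Matrix (Fin m) (Fin m) R}

lemma two_mul_cancel {a b : R} (h : 2 * a = 2 * b) : a = b := by
  have h2 : algebraMap ℝ R (1 / 2) * 2 = 1 := by
    rw [← map_ofNat (algebraMap ℝ R) 2, ← map_mul]; norm_num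
  calc a = algebraMap ℝ R (1 / 2) * (2 * a) := by rw [← mul_assoc, h2, one_mul]
    _ = b := by rw [h, ← mul_assoc, h2, one_mul]

/-- The Koszul formula. -/
lemma IsLeviCivita.koszul (h : IsLeviCivita D G Gi Γ) (i j l : Fin m) :
    2 * (G * Γ i) l j = D i (G j l) + D j (G i l) - D l (G i j) := by
  have hs : ∀ a b, G a b = G b a := fun a b => congrFun (congrFun h.symm b) a
  have hc : ∀ i a b, D i (G a b) = (G * Γ i) b a + (G * Γ i) a b := by
    intro i a b
    have := congrFun (congrFun (h.compat i) a) b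
    rw [matD_apply, Matrix.add_apply] at this
    rw [this]
    congr 1
    rw [mul_apply, mul_apply]
    exact Finset.sum_congr rfl fun k _ => by rw [transpose_apply, hs b k, mul_comm]
  have ht : ∀ i a b, (G * Γ i) a b = (G * Γ b) a i := by
    intro i a b
    rw [mul_apply, mul_apply]
    exact Finset.sum_congr rfl fun k _ => by rw [h.torsion]
  rw [hc, hc, hc, ht i l j, ht j i l, ht i j l]; ring

/-- Converse to `koszul`: it allows Christoffel symbols given by the coordinate formula to be
recognised as a Levi-Civita connection. -/
lemma isLeviCivita_of_koszul (symm : Gᵀ = G) (inv_mul : Gi * G = 1)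
    (hk : ∀ i j l, 2 * (G * Γ i) l j = D i (G j l) + D j (G i l) - D l (G i j)) :
    IsLeviCivita D G Gi Γ := by
  have hs : ∀ a b, G a b = G b a := fun a b => congrFun (congrFun symm b) a
  have hΓ : ∀ i, Γ i = Gi * (G * Γ i) := fun i => by rw [← mul_assoc, inv_mul, one_mul]
  refine ⟨symm, inv_mul, fun i j k => ?_, fun i => ?_⟩
  · rw [hΓ i, hΓ j, mul_apply, mul_apply]
    refine Finset.sum_congr rfl fun l _ => ?_
    congr 1
    apply two_mul_cancel
    rw [hk, hk, hs j i]; ring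
  · ext a b
    apply two_mul_cancel
    have e1 : ((Γ i)ᵀ * G) a b = (G * Γ i) b a := by
      rw [mul_apply, mul_apply]
      exact Finset.sum_congr rfl fun k _ => by rw [transpose_apply, hs b k, mul_comm]
    rw [matD_apply, Matrix.add_apply, e1, mul_add, hk, hk, hs b a]; ring

/-- Koszul determines `G * Γ i`, and `G` is invertible. -/
lemma IsLeviCivita.unique (h : IsLeviCivita D G Gi Γ) (h' : IsLeviCivita D G Gi Γ') : Γ = Γ' := by
  funext i
  have : G * Γ i = G * Γ' i := by
    ext a b
    exact two_mul_cancel (by rw [h.koszul, h'.koszul])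
  calc Γ i = Gi * (G * Γ i) := by rw [← mul_assoc, h.inv_mul, one_mul]
    _ = Γ' i := by rw [this, ← mul_assoc, h.inv_mul, one_mul]

/-- The transformation law of the Levi-Civita connection under a change of coordinates with
Jacobian matrix `A`. -/
lemma IsLeviCivita.mul_change (h : IsLeviCivita D G Gi Γ)
    {K A Ai : Matrix (Fin m) (Fin m) R} {ΓK : Fin m → Matrix (Fin m) (Fin m) R}
    (hG : G = Aᵀ * K * A) (hA : A * Ai = 1) (hAD : ∀ i j c, D i (A c j) = D j (A c i))
    (htor : ∀ a b c, ΓK a c b = ΓK b c a)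
    (hK : ∀ i, matD D i K = ∑ a, A a i • ((ΓK a)ᵀ * K + K * ΓK a)) (i : Fin m) :
    A * Γ i = matD D i A + (∑ a, A a i • ΓK a) * A := by
  have hA' : Ai * A = 1 := mul_eq_one_comm.mp hA
  have hT : Aᵀ * Aiᵀ = 1 := by rw [← transpose_mul, hA', transpose_one]
  -- The connection predicted by the transformation law. It is checked to be torsion-free and
  -- metric, so uniqueness identifies it with `Γ`; the Christoffel formula is never transformed by
  -- hand.
  let Γ' : Fin m → Matrix (Fin m) (Fin m) R := fun i =>
    Ai * (matD D i A + (∑ a, A a i • ΓK a) * A)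
  have hAΓ : ∀ i, A * Γ' i = matD D i A + (∑ a, A a i • ΓK a) * A := fun i => by
    rw [← mul_assoc, hA, one_mul]
  have h' : IsLeviCivita D G Gi Γ' := by
    refine ⟨h.symm, h.inv_mul, fun i j k => ?_, fun i => ?_⟩
    · simp only [Γ', mul_apply (M := Ai)]
      refine Finset.sum_congr rfl fun c _ => ?_
      rw [Matrix.add_apply, Matrix.add_apply, matD_apply, matD_apply, hAD]
      congr 2
      simp only [mul_apply, Matrix.sum_apply, Matrix.smul_apply, smul_eq_mul, Finset.sum_mul]
      rw [Finset.sum_comm]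
      exact Finset.sum_congr rfl fun a _ => Finset.sum_congr rfl fun b _ => by
        rw [htor]; ring
    · have e1 : G * Γ' i = Aᵀ * K * (matD D i A + (∑ a, A a i • ΓK a) * A) := by
        rw [hG, mul_assoc, hAΓ]
      have e2 : (Γ' i)ᵀ * G = (matD D i A + (∑ a, A a i • ΓK a) * A)ᵀ * K * A := by
        have e0 : (Γ' i)ᵀ * Aᵀ = (A * Γ' i)ᵀ := (transpose_mul _ _).symm
        rw [hG, ← hAΓ, ← e0]
        simp only [mul_assoc]
      have e3 : matD D i K = (∑ a, A a i • ΓK a)ᵀ * K + K * (∑ a, A a i • ΓK a) := by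
        rw [hK, transpose_sum, Finset.sum_mul, Finset.mul_sum, ← Finset.sum_add_distrib]
        exact Finset.sum_congr rfl fun a _ => by
          rw [transpose_smul, smul_mul_assoc, mul_smul_comm, smul_add]
      rw [e1, e2]
      nth_rewrite 1 [hG]
      rw [matD_mul, matD_mul, e3, matD_transpose, transpose_add, transpose_mul]
      noncomm_ring
  rw [h.unique h', hAΓ]

/-- The Hessian is a tensor. -/
lemma IsLeviCivita.hessM_change (h : IsLeviCivita D G Gi Γ)
    {K A Ai : Matrix (Fin m) (Fin m) R} {ΓK : Fin m → Matrix (Fin m) (Fin m) R}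
    (hG : G = Aᵀ * K * A) (hA : A * Ai = 1) (hAD : ∀ i j c, D i (A c j) = D j (A c i))
    (htor : ∀ a b c, ΓK a c b = ΓK b c a)
    (hK : ∀ i, matD D i K = ∑ a, A a i • ((ΓK a)ᵀ * K + K * ΓK a))
    {f : R} {df : Fin m → R} {ddf : Matrix (Fin m) (Fin m) R}
    (hf : ∀ i, D i f = ∑ a, df a * A a i) (hdf : ∀ i a, D i (df a) = ∑ b, ddf b a * A b i) :
    hessM D Γ f = Aᵀ * Matrix.of (fun a b => ddf a b - ∑ c, df c * ΓK a c b) * A := by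
  ext i j
  -- Only `A * Γ i` is needed, which `mul_change` supplies; its inhomogeneous term `D A` cancels the
  -- second derivatives of the coordinate change.
  have h1 : ∑ k, D k f * Γ i k j = ∑ c, df c * (A * Γ i) c j := by
    simp only [hf, mul_apply, Finset.sum_mul, Finset.mul_sum]
    rw [Finset.sum_comm]
    exact Finset.sum_congr rfl fun c _ => Finset.sum_congr rfl fun k _ => by ring
  simp only [hessM, of_apply, covVec]
  rw [h1, hf j]
  simp only [h.mul_change hG hA hAD htor hK, map_sum, Derivation.leibniz, smul_eq_mul, hdf,
    Matrix.add_apply, matD_apply, mul_add, Finset.sum_add_distrib]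
  have h2 : ∑ c, df c * ((∑ a, A a i • ΓK a) * A) c j
      = ∑ b, ∑ a, A a i * (∑ c, df c * ΓK a c b) * A b j := by
    simp only [mul_apply, Matrix.sum_apply, Matrix.smul_apply, smul_eq_mul, Finset.sum_mul,
      Finset.mul_sum]
    rw [Finset.sum_comm]
    refine Finset.sum_congr rfl fun b _ => ?_
    rw [Finset.sum_comm]
    exact Finset.sum_congr rfl fun c _ => Finset.sum_congr rfl fun k _ => by ring
  rw [h2]
  simp only [mul_apply, transpose_apply, of_apply, mul_sub, sub_mul, Finset.sum_sub_distrib,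
    Finset.sum_mul, Finset.mul_sum]
  have h3 : ∑ x, ∑ y, A x j * (ddf y x * A y i) = ∑ x, ∑ y, A y i * ddf y x * A x j :=
    Finset.sum_congr rfl fun c _ => Finset.sum_congr rfl fun k _ => by ring
  rw [h3]; ring

/-- Traces with respect to the metric are invariant under changes of coordinates. -/
lemma IsLeviCivita.trace_change (h : IsLeviCivita D G Gi Γ)
    {K Ki A Ai : Matrix (Fin m) (Fin m) R} (hG : G = Aᵀ * K * A) (hA : A * Ai = 1)
    (hKi : Ki * K = 1) (T : Matrix (Fin m) (Fin m) R) :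
    trace (Gi * (Aᵀ * T * A)) = trace (Ki * T) := by
  have hA' : Ai * A = 1 := mul_eq_one_comm.mp hA
  have hT : Aiᵀ * Aᵀ = 1 := by rw [← transpose_mul, hA, transpose_one]
  have hi : Gi = Ai * Ki * Aiᵀ := by
    have : Ai * Ki * Aiᵀ * G = 1 := by
      calc Ai * Ki * Aiᵀ * G = Ai * (Ki * ((Aiᵀ * Aᵀ) * K)) * A := by
            rw [hG]; simp only [mul_assoc]
        _ = 1 := by rw [hT, one_mul, hKi, mul_one, hA']
    calc Gi = (Ai * Ki * Aiᵀ * G) * Gi := by rw [this, one_mul]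
      _ = _ := by rw [mul_assoc _ G, h.mul_inv, mul_one]
  rw [hi]
  calc trace (Ai * Ki * Aiᵀ * (Aᵀ * T * A)) = trace (Ai * (Ki * ((Aiᵀ * Aᵀ) * T) * A)) := by
        simp only [mul_assoc]
    _ = trace (Ki * T * (A * Ai)) := by
        rw [hT, one_mul, trace_mul_comm, mul_assoc]
    _ = trace (Ki * T) := by rw [hA, mul_one]

end Algebraic

end RHSoliton

namespace RHSoliton

open Matrix

section Smooth

variable {m n : ℕ} {W : Set (EuclideanSpace ℝ (Fin m))}

/-! ### Smooth functions on an open subset of Euclidean space -/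

lemma contDiffOn_pd (hW : IsOpen W) {F : EuclideanSpace ℝ (Fin m) → ℝ}
    (hF : ContDiffOn ℝ ∞ F W) (i : Fin m) : ContDiffOn ℝ ∞ (pd i F) W :=
  (hF.fderiv_of_isOpen hW (by simp)).clm_apply contDiffOn_const

lemma pd_congr (hW : IsOpen W) {F F' : EuclideanSpace ℝ (Fin m) → ℝ}
    (h : ∀ y ∈ W, F y = F' y) (i : Fin m) : ∀ y ∈ W, pd i F y = pd i F' y := by
  intro y hy
  have : F =ᶠ[nhds y] F' := Filter.eventuallyEq_of_mem (hW.mem_nhds hy) h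
  rw [pd, pd, this.fderiv_eq]

lemma differentiableAt_of_contDiffOn (hW : IsOpen W) {F : EuclideanSpace ℝ (Fin m) → ℝ}
    (hF : ContDiffOn ℝ ∞ F W) {y : EuclideanSpace ℝ (Fin m)} (hy : y ∈ W) :
    DifferentiableAt ℝ F y :=
  (hF.contDiffAt (hW.mem_nhds hy)).differentiableAt (by simp)

lemma pd_pd (hW : IsOpen W) {F : EuclideanSpace ℝ (Fin m) → ℝ}
    (hF : ContDiffOn ℝ ∞ F W) (i j : Fin m) {y : EuclideanSpace ℝ (Fin m)} (hy : y ∈ W) :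
    pd i (pd j F) y =
      fderiv ℝ (fderiv ℝ F) y (EuclideanSpace.single i 1) (EuclideanSpace.single j 1) := by
  have hd : DifferentiableAt ℝ (fderiv ℝ F) y :=
    ((hF.fderiv_of_isOpen (m := ∞) hW (by simp)).contDiffAt (hW.mem_nhds hy)).differentiableAt
      (by simp)
  have : pd j F = fun z => fderiv ℝ F z (EuclideanSpace.single j 1) := rfl
  rw [pd, this, fderiv_clm_apply hd (differentiableAt_const _)]
  simp

lemma pd_comm (hW : IsOpen W) {F : EuclideanSpace ℝ (Fin m) → ℝ}
    (hF : ContDiffOn ℝ ∞ F W) (i j : Fin m) {y : EuclideanSpace ℝ (Fin m)} (hy : y ∈ W) :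
    pd i (pd j F) y = pd j (pd i F) y := by
  have hs : IsSymmSndFDerivAt ℝ F y :=
    (hF.contDiffAt (hW.mem_nhds hy)).isSymmSndFDerivAt (by simpa using ENat.LEInfty.out)
  rw [pd_pd hW hF i j hy, pd_pd hW hF j i hy, hs.eq]

/-- The algebra of smooth functions on `W`. -/
def smoothFun (W : Set (EuclideanSpace ℝ (Fin m))) : Subalgebra ℝ (W → ℝ) where
  -- Elements are functions on `W` alone, so that equality in the ring is equality on `W`; the
  -- representative `F` on the whole space exists only for `pd` to be applicable.
  carrier := {f | ∃ F : EuclideanSpace ℝ (Fin m) → ℝ, ContDiffOn ℝ ∞ F W ∧ ∀ z : W, F z = f z}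
  mul_mem' := by
    rintro f g ⟨F, hF, hf⟩ ⟨F', hF', hg⟩
    exact ⟨fun z => F z * F' z, hF.mul hF', fun z => by simp [hf, hg]⟩
  add_mem' := by
    rintro f g ⟨F, hF, hf⟩ ⟨F', hF', hg⟩
    exact ⟨fun z => F z + F' z, hF.add hF', fun z => by simp [hf, hg]⟩
  algebraMap_mem' r := ⟨fun _ => r, contDiffOn_const, fun _ => rfl⟩

/-- The restriction of a smooth function to `W`. -/
def mkS (F : EuclideanSpace ℝ (Fin m) → ℝ) (hF : ContDiffOn ℝ ∞ F W) : smoothFun W :=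
  ⟨fun z => F z, F, hF, fun _ => rfl⟩

/-- Evaluation at a point of `W`. -/
def evS (y : W) : smoothFun W →ₐ[ℝ] ℝ := (Pi.evalAlgHom ℝ (fun _ : W => ℝ) y).comp (smoothFun W).val

@[simp] lemma evS_mkS (y : W) (F : EuclideanSpace ℝ (Fin m) → ℝ) (hF : ContDiffOn ℝ ∞ F W) :
    evS y (mkS F hF) = F y := rfl

lemma ext_evS {f g : smoothFun W} (h : ∀ y, evS y f = evS y g) : f = g :=
  Subtype.ext (funext h)

lemma exists_mkS (f : smoothFun W) : ∃ F, ∃ hF : ContDiffOn ℝ ∞ F W, f = mkS F hF := by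
  obtain ⟨F, hF, h⟩ := f.2
  exact ⟨F, hF, Subtype.ext (funext fun z => (h z).symm)⟩

/-- A smooth function on the whole space representing an element of the algebra on `W`. -/
noncomputable def extS (f : smoothFun W) : EuclideanSpace ℝ (Fin m) → ℝ := (exists_mkS f).choose

lemma contDiffOn_extS (f : smoothFun W) : ContDiffOn ℝ ∞ (extS f) W :=
  (exists_mkS f).choose_spec.choose

lemma extS_apply (f : smoothFun W) (y : W) : extS f y = evS y f := by
  conv_rhs => rw [(exists_mkS f).choose_spec.choose_spec]
  rfl

/-- The partial derivatives on the algebra of smooth functions. -/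
noncomputable def derS (hW : IsOpen W) (i : Fin m) : Derivation ℝ (smoothFun W) (smoothFun W) :=
  Derivation.mk'
    { toFun := fun f => mkS (pd i (extS f)) (contDiffOn_pd hW (contDiffOn_extS f) i)
      map_add' := fun f g => ext_evS fun y => by
        have h1 := pd_congr hW (F := extS (f + g)) (F' := fun z => extS f z + extS g z)
          (fun z hz => by rw [extS_apply _ ⟨z, hz⟩, extS_apply _ ⟨z, hz⟩, extS_apply _ ⟨z, hz⟩,
            map_add]) i y y.2
        rw [map_add, evS_mkS, evS_mkS, evS_mkS, h1, pd, fderiv_fun_add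
          (differentiableAt_of_contDiffOn hW (contDiffOn_extS f) y.2)
          (differentiableAt_of_contDiffOn hW (contDiffOn_extS g) y.2)]
        rfl
      map_smul' := fun r f => ext_evS fun y => by
        have h1 := pd_congr hW (F := extS (r • f)) (F' := fun z => r * extS f z)
          (fun z hz => by rw [extS_apply _ ⟨z, hz⟩, extS_apply _ ⟨z, hz⟩, map_smul,
            smul_eq_mul]) i y y.2
        rw [RingHom.id_apply, map_smul, evS_mkS, evS_mkS, h1, pd, fderiv_const_mul
          (differentiableAt_of_contDiffOn hW (contDiffOn_extS f) y.2)]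
        rfl }
    fun f g => ext_evS fun y => by
      have h1 := pd_congr hW (F := extS (f * g)) (F' := fun z => extS f z * extS g z)
        (fun z hz => by rw [extS_apply _ ⟨z, hz⟩, extS_apply _ ⟨z, hz⟩, extS_apply _ ⟨z, hz⟩,
          map_mul]) i y y.2
      simp only [LinearMap.coe_mk, AddHom.coe_mk, smul_eq_mul, map_add, map_mul, evS_mkS]
      rw [h1, pd, fderiv_fun_mul
        (differentiableAt_of_contDiffOn hW (contDiffOn_extS f) y.2)
        (differentiableAt_of_contDiffOn hW (contDiffOn_extS g) y.2)]
      simp [pd, extS_apply]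

/-- The chosen extension is immaterial: on an open set, partial derivatives depend only on the
values there. -/
lemma derS_mkS (hW : IsOpen W) (i : Fin m) (F : EuclideanSpace ℝ (Fin m) → ℝ)
    (hF : ContDiffOn ℝ ∞ F W) :
    derS hW i (mkS F hF) = mkS (pd i F) (contDiffOn_pd hW hF i) :=
  ext_evS fun y => pd_congr hW (fun z hz => by rw [extS_apply _ ⟨z, hz⟩]; rfl) i y y.2

lemma derS_comm (hW : IsOpen W) (i j : Fin m) (f : smoothFun W) :
    derS hW i (derS hW j f) = derS hW j (derS hW i f) := by
  obtain ⟨F, hF, rfl⟩ := exists_mkS f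
  simp only [derS_mkS]
  exact ext_evS fun y => pd_comm hW hF i j y.2

lemma contDiffOn_det {ι : Type*} [Fintype ι] [DecidableEq ι]
    {A : EuclideanSpace ℝ (Fin m) → Matrix ι ι ℝ}
    (hA : ∀ i j, ContDiffOn ℝ ∞ (fun z => A z i j) W) : ContDiffOn ℝ ∞ (fun z => (A z).det) W := by
  simp only [det_apply']
  exact ContDiffOn.sum fun σ _ => contDiffOn_const.mul (contDiffOn_prod fun i _ => hA _ _)

lemma contDiffOn_matrix_inv {ι : Type*} [Fintype ι] [DecidableEq ι]
    {A : EuclideanSpace ℝ (Fin m) → Matrix ι ι ℝ}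
    (hA : ∀ i j, ContDiffOn ℝ ∞ (fun z => A z i j) W) (hdet : ∀ z ∈ W, (A z).det ≠ 0) (i j : ι) :
    ContDiffOn ℝ ∞ (fun z => (A z)⁻¹ i j) W := by
  simp only [inv_def, Ring.inverse_eq_inv', Matrix.smul_apply, smul_eq_mul, adjugate_apply]
  refine ((contDiffOn_det hA).inv hdet).mul (contDiffOn_det fun a b => ?_)
  simp only [updateRow_apply]
  split_ifs
  · exact contDiffOn_const
  · exact hA _ _

/-- A smooth field of positive definite symmetric matrices on an open set. -/
structure IsMetricOn (G : EuclideanSpace ℝ (Fin m) → Matrix (Fin m) (Fin m) ℝ)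
    (W : Set (EuclideanSpace ℝ (Fin m))) : Prop where
  isOpen : IsOpen W
  smooth : ∀ i j, ContDiffOn ℝ ∞ (fun z => G z i j) W
  posDef : ∀ z ∈ W, (G z).PosDef

namespace IsMetricOn

variable {G : EuclideanSpace ℝ (Fin m) → Matrix (Fin m) (Fin m) ℝ} (hG : IsMetricOn G W)

include hG

lemma det_ne_zero {z : EuclideanSpace ℝ (Fin m)} (hz : z ∈ W) : (G z).det ≠ 0 :=
  (hG.posDef z hz).det_pos.ne'

lemma symm_apply {z : EuclideanSpace ℝ (Fin m)} (hz : z ∈ W) (i j : Fin m) :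
    G z i j = G z j i := by
  simpa using (hG.posDef z hz).isHermitian.apply j i

end IsMetricOn

end Smooth

end RHSoliton

/-! ### Coordinate expressions as values of the algebraic ones -/

namespace RHSoliton

open Matrix

section Coordinates

variable {m n : ℕ} {W : Set (EuclideanSpace ℝ (Fin m))} {V : Set (EuclideanSpace ℝ (Fin n))}

lemma contDiffOn_coord {U : EuclideanSpace ℝ (Fin m) → EuclideanSpace ℝ (Fin n)}
    (hU : ContDiffOn ℝ ∞ U W) (a : Fin n) : ContDiffOn ℝ ∞ (fun z => U z a) W :=
  (contDiff_euclidean.mp contDiff_id a).comp_contDiffOn hU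

lemma fderiv_eq_sum_pd (F : EuclideanSpace ℝ (Fin n) → ℝ) (y v : EuclideanSpace ℝ (Fin n)) :
    fderiv ℝ F y v = ∑ e, v e * pd e F y := by
  have hv : v = ∑ e, v e • EuclideanSpace.single e (1 : ℝ) := by
    ext j; simp [Finset.sum_apply, Pi.single_apply]
  conv_lhs => rw [hv]
  simp [pd]

/-- The chain rule for partial derivatives. -/
lemma pd_comp {F : EuclideanSpace ℝ (Fin n) → ℝ}
    {U : EuclideanSpace ℝ (Fin m) → EuclideanSpace ℝ (Fin n)} {y : EuclideanSpace ℝ (Fin m)}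
    (hF : DifferentiableAt ℝ F (U y)) (hU : DifferentiableAt ℝ U y) (i : Fin m) :
    pd i (fun z => F (U z)) y = ∑ e, pd e F (U y) * pd i (fun z => U z e) y := by
  have h1 : pd i (fun z => F (U z)) y = fderiv ℝ F (U y) (fderiv ℝ U y (EuclideanSpace.single i 1)) := by
    rw [pd, show (fun z => F (U z)) = F ∘ U from rfl, fderiv_comp y hF hU]; rfl
  rw [h1, fderiv_eq_sum_pd]
  refine Finset.sum_congr rfl fun e _ => ?_
  have h2 : pd i (fun z => U z e) y = fderiv ℝ U y (EuclideanSpace.single i 1) e := by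
    have : (fun z => U z e) = (EuclideanSpace.proj (𝕜 := ℝ) e) ∘ U := rfl
    rw [pd, this, fderiv_comp y (ContinuousLinearMap.differentiableAt _) hU,
      ContinuousLinearMap.fderiv]
    rfl
  rw [h2, mul_comm]

/-- Koszul's formula in coordinates. It serves twice: for the connection of the source, and as
hypothesis `hΓ` on the target in `derivation_soliton`. -/
lemma two_mul_sum_christoffel {G : EuclideanSpace ℝ (Fin m) → Matrix (Fin m) (Fin m) ℝ}
    {y : EuclideanSpace ℝ (Fin m)} (hdet : (G y).det ≠ 0) (l i j : Fin m) :
    2 * ∑ k, G y l k * christoffel G k i j y =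
      pd i (fun z => G z j l) y + pd j (fun z => G z i l) y - pd l (fun z => G z i j) y := by
  simp only [christoffel]
  set X : Fin m → ℝ := fun l =>
    pd i (fun z => G z j l) y + pd j (fun z => G z i l) y - pd l (fun z => G z i j) y with hX
  have h1 : ∀ k, ∑ p, (G y)⁻¹ k p * X p = ((G y)⁻¹ *ᵥ X) k := fun k => rfl
  have h2 : (G y *ᵥ ((G y)⁻¹ *ᵥ X)) l = X l := by
    rw [mulVec_mulVec, mul_nonsing_inv _ (isUnit_iff_ne_zero.mpr hdet), one_mulVec]
  change 2 * ∑ k, G y l k * (1 / 2 * ∑ p, (G y)⁻¹ k p * X p) = X l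
  simp only [h1]
  rw [← h2, mulVec, dotProduct, Finset.mul_sum]
  exact Finset.sum_congr rfl fun k _ => by ring

/-- The squared norm of the gradient in coordinates. -/
noncomputable def gradNormSq (G : EuclideanSpace ℝ (Fin m) → Matrix (Fin m) (Fin m) ℝ)
    (F : EuclideanSpace ℝ (Fin m) → ℝ) (y : EuclideanSpace ℝ (Fin m)) : ℝ :=
  ∑ i, ∑ j, (G y)⁻¹ i j * (pd i F y * pd j F y)

namespace IsMetricOn

variable {G : EuclideanSpace ℝ (Fin m) → Matrix (Fin m) (Fin m) ℝ} (hG : IsMetricOn G W)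

include hG

lemma contDiffOn_inv (i j : Fin m) : ContDiffOn ℝ ∞ (fun z => (G z)⁻¹ i j) W :=
  contDiffOn_matrix_inv hG.smooth (fun _ hz => hG.det_ne_zero hz) i j

lemma contDiffOn_christoffel (k i j : Fin m) : ContDiffOn ℝ ∞ (christoffel G k i j) W := by
  unfold christoffel
  refine contDiffOn_const.mul (ContDiffOn.sum fun l _ => (hG.contDiffOn_inv k l).mul ?_)
  exact ((contDiffOn_pd hG.isOpen (hG.smooth _ _) _).add
    (contDiffOn_pd hG.isOpen (hG.smooth _ _) _)).sub (contDiffOn_pd hG.isOpen (hG.smooth _ _) _)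

lemma christoffel_symm (k i j : Fin m) {y : EuclideanSpace ℝ (Fin m)} (hy : y ∈ W) :
    christoffel G k i j y = christoffel G k j i y := by
  unfold christoffel
  congr 1
  refine Finset.sum_congr rfl fun l _ => ?_
  rw [pd_congr hG.isOpen (fun z hz => hG.symm_apply hz i j) l y hy]
  ring

/-- The metric as a matrix of smooth functions. -/
def mat : Matrix (Fin m) (Fin m) (smoothFun W) := Matrix.of fun i j => mkS _ (hG.smooth i j)

/-- The inverse metric as a matrix of smooth functions. -/
noncomputable def matInv : Matrix (Fin m) (Fin m) (smoothFun W) :=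
  Matrix.of fun i j => mkS _ (hG.contDiffOn_inv i j)

/-- The Christoffel symbols as matrices of smooth functions. -/
noncomputable def conn (i : Fin m) : Matrix (Fin m) (Fin m) (smoothFun W) :=
  Matrix.of fun k j => mkS _ (hG.contDiffOn_christoffel k j i)

lemma mat_symm : hG.matᵀ = hG.mat := by
  exact Matrix.ext fun i j => ext_evS fun y => hG.symm_apply y.2 j i

lemma matInv_mul : hG.matInv * hG.mat = 1 := by
  refine Matrix.ext fun i j => ext_evS fun y => ?_
  have h := congrFun (congrFun (nonsing_inv_mul (G y)
    (isUnit_iff_ne_zero.mpr (hG.det_ne_zero y.2))) i) j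
  rw [mul_apply] at h ⊢
  simp only [map_sum, map_mul, mat, matInv, of_apply, evS_mkS]
  rw [h, Matrix.one_apply, Matrix.one_apply]
  split_ifs <;> simp

lemma isLeviCivita : IsLeviCivita (derS hG.isOpen) hG.mat hG.matInv hG.conn := by
  refine isLeviCivita_of_koszul hG.mat_symm hG.matInv_mul fun i j l => ext_evS fun y => ?_
  have h := two_mul_sum_christoffel (hG.det_ne_zero y.2) l j i
  have h2 := pd_congr hG.isOpen (fun z hz => hG.symm_apply hz j i) l y y.2
  simp only [mul_apply, map_add, map_sub, map_mul, map_sum, mat, conn, of_apply, evS_mkS,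
    derS_mkS, map_ofNat]
  rw [h, h2]; ring

lemma evS_hessM {F : EuclideanSpace ℝ (Fin m) → ℝ} (hF : ContDiffOn ℝ ∞ F W) (i j : Fin m)
    (y : W) : evS y (hessM (derS hG.isOpen) hG.conn (mkS F hF) i j) = hess G F i j y := by
  simp only [hessM, covVec, of_apply, conn, derS_mkS, map_sub, map_sum, map_mul, evS_mkS, hess]
  congr 1
  exact Finset.sum_congr rfl fun k _ => by rw [hG.christoffel_symm k i j y.2, mul_comm]

lemma evS_laplacian {F : EuclideanSpace ℝ (Fin m) → ℝ} (hF : ContDiffOn ℝ ∞ F W) (y : W) :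
    evS y (trace (hG.matInv * hessM (derS hG.isOpen) hG.conn (mkS F hF))) = lap G F y := by
  have hs : ∀ i j, hess G F i j y = hess G F j i y := fun i j => by
    rw [← hG.evS_hessM hF, ← hG.evS_hessM hF, hG.isLeviCivita.hessM_symm (derS_comm hG.isOpen)]
  simp only [trace, diag_apply, mul_apply, map_sum, map_mul, hG.evS_hessM, lap, matInv, of_apply,
    evS_mkS]
  exact Finset.sum_congr rfl fun i _ => Finset.sum_congr rfl fun j _ => by rw [hs]

lemma evS_gradSq {F : EuclideanSpace ℝ (Fin m) → ℝ} (hF : ContDiffOn ℝ ∞ F W) (y : W) :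
    evS y (gradSq (derS hG.isOpen) hG.matInv (mkS F hF)) = gradNormSq G F y := by
  simp only [gradSq, trace, diag_apply, mul_apply, map_sum, map_mul, vecMulVec_apply, derS_mkS,
    matInv, of_apply, evS_mkS, gradNormSq]
  exact Finset.sum_congr rfl fun i _ => Finset.sum_congr rfl fun j _ => by ring

lemma evS_ric (p b : Fin m) (y : W) :
    evS y (ric (derS hG.isOpen) hG.conn p b) = ricci G p b y := by
  simp only [ric, curv, of_apply, map_sum, Matrix.add_apply, Matrix.sub_apply, matD_apply,
    mul_apply, map_add, map_sub, map_mul, conn, derS_mkS, evS_mkS, ricci]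
  rw [← Finset.sum_add_distrib]
  refine Finset.sum_congr rfl fun k _ => ?_
  rw [Finset.sum_sub_distrib]
  simp only [hG.christoffel_symm k _ k y.2]
  have : ∑ x, christoffel G k x b y * christoffel G x p k y
      = ∑ x, christoffel G k b x y * christoffel G x p k y :=
    Finset.sum_congr rfl fun x _ => by rw [hG.christoffel_symm k x b y.2]
  rw [this]; ring

/-- For a gradient soliton with `σ` constant, `Δ F - |∇F|² + 2 c F` has vanishing differential. -/
theorem pd_soliton {H : EuclideanSpace ℝ (Fin n) → Matrix (Fin n) (Fin n) ℝ}
    (hH : IsMetricOn H V) {U : EuclideanSpace ℝ (Fin m) → EuclideanSpace ℝ (Fin n)}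
    (hU : ContDiffOn ℝ ∞ U W) (hUV : Set.MapsTo U W V)
    {F : EuclideanSpace ℝ (Fin m) → ℝ} (hF : ContDiffOn ℝ ∞ F W) {α c : ℝ}
    (hric : ∀ y ∈ W, ∀ i j, scTensor α G H U i j y + hess G F i j y = c * G y i j)
    (hten : ∀ y ∈ W, ∀ ν, tension G H U ν y - gradPair G U F ν y = 0) :
    ∃ Q : EuclideanSpace ℝ (Fin m) → ℝ, ContDiffOn ℝ ∞ Q W ∧
      (∀ y ∈ W, Q y = lap G F y - gradNormSq G F y + 2 * c * F y) ∧
      ∀ y ∈ W, ∀ i, pd i Q y = 0 := by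
  have hUd : ∀ y ∈ W, DifferentiableAt ℝ U y := fun y hy =>
    (hU.contDiffAt (hG.isOpen.mem_nhds hy)).differentiableAt (by simp)
  -- Target quantities enter the ring over `W` by composition with `U`. Their derivatives are then
  -- governed by the chain rule, which is all `derivation_soliton` asks of the target.
  let Hm : Matrix (Fin n) (Fin n) (smoothFun W) :=
    Matrix.of fun a b => mkS (fun z => H (U z) a b) ((hH.smooth a b).comp hU hUV)
  let dH : Fin n → Matrix (Fin n) (Fin n) (smoothFun W) := fun e =>
    Matrix.of fun a b => mkS (fun z => pd e (fun w => H w a b) (U z))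
      ((contDiffOn_pd hH.isOpen (hH.smooth a b) e).comp hU hUV)
  let ΓH : Fin n → Fin n → Fin n → smoothFun W := fun a b c =>
    mkS (fun z => christoffel H a b c (U z)) ((hH.contDiffOn_christoffel a b c).comp hU hUV)
  let Um : Fin n → smoothFun W := fun a => mkS (fun z => U z a) (contDiffOn_coord hU a)
  have key := hG.isLeviCivita.derivation_soliton (derS_comm hG.isOpen) (H := Hm) (U := Um)
    (dH := dH) (ΓH := ΓH) (α := α) (c := c) (f := mkS F hF) ?_ ?_ ?_ ?_ ?_
  · obtain ⟨Q, hQ, hQe⟩ := exists_mkS (trace (hG.matInv * hessM (derS hG.isOpen) hG.conn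
      (mkS F hF)) - gradSq (derS hG.isOpen) hG.matInv (mkS F hF)
      + 2 * algebraMap ℝ (smoothFun W) c * mkS F hF)
    refine ⟨Q, hQ, fun y hy => ?_, fun y hy i => ?_⟩
    · have := congrArg (evS (⟨y, hy⟩ : W)) hQe
      rw [evS_mkS, map_add, map_sub, hG.evS_laplacian, hG.evS_gradSq, map_mul, map_mul, evS_mkS,
        map_ofNat, AlgHom.commutes] at this
      exact this.symm
    · have := congrArg (evS (⟨y, hy⟩ : W)) (key i)
      rwa [hQe, derS_mkS, evS_mkS, map_zero] at this
  · exact Matrix.ext fun a b => ext_evS fun y => hH.symm_apply (hUV y.2) b a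
  · intro i a b
    refine ext_evS fun y => ?_
    simp only [Hm, dH, Um, of_apply, derS_mkS, map_sum, map_mul, evS_mkS]
    exact pd_comp (differentiableAt_of_contDiffOn hH.isOpen (hH.smooth a b) (hUV y.2))
      (hUd y y.2) i
  · intro a d e
    refine ext_evS fun y => ?_
    simp only [Hm, dH, ΓH, of_apply, map_sum, map_mul, map_add, map_sub, map_ofNat, evS_mkS]
    exact two_mul_sum_christoffel (hH.det_ne_zero (hUV y.2)) a d e
  · intro i j
    refine ext_evS fun y => ?_
    have h1 : evS y (pullM (derS hG.isOpen) Hm Um i j) = pull H U i j y := by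
      simp only [pullM, Matrix.sum_apply, Matrix.smul_apply, vecMulVec_apply, smul_eq_mul, map_sum,
        map_mul, Hm, Um, of_apply, derS_mkS, evS_mkS, pull, mul_assoc]
    have h2 := hric y y.2 i j
    rw [map_add, map_sub, map_mul, map_mul, hG.evS_ric, hG.evS_hessM, h1, AlgHom.commutes,
      AlgHom.commutes]
    exact h2
  · intro b
    refine ext_evS fun y => ?_
    have h2 := hten y y.2 b
    rw [sub_eq_zero] at h2
    simp only [map_sum, map_mul, map_add]
    simp only [Um, ΓH, derS_mkS, evS_mkS, hG.evS_hessM, matInv, of_apply]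
    exact h2

end IsMetricOn

end Coordinates

end RHSoliton

/-! ### Invariance of the Laplacian and the gradient norm -/

namespace RHSoliton

open Matrix

section Change

variable {m : ℕ} {W V : Set (EuclideanSpace ℝ (Fin m))}
  {G K : EuclideanSpace ℝ (Fin m) → Matrix (Fin m) (Fin m) ℝ}

/-- The Jacobian matrix. -/
noncomputable def jacobian (φ : EuclideanSpace ℝ (Fin m) → EuclideanSpace ℝ (Fin m))
    (y : EuclideanSpace ℝ (Fin m)) : Matrix (Fin m) (Fin m) ℝ :=
  Matrix.of fun a i => pd i (fun z => φ z a) y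

/-- The Laplacian and the gradient norm are invariant under changes of coordinates. -/
theorem IsMetricOn.invariance (hG : IsMetricOn G W) (hK : IsMetricOn K V)
    {φ : EuclideanSpace ℝ (Fin m) → EuclideanSpace ℝ (Fin m)} (hφ : ContDiffOn ℝ ∞ φ W)
    (hWV : Set.MapsTo φ W V)
    (hGK : ∀ y ∈ W, G y = (jacobian φ y)ᵀ * K (φ y) * jacobian φ y)
    {F : EuclideanSpace ℝ (Fin m) → ℝ} (hF : ContDiffOn ℝ ∞ F V)
    {y : EuclideanSpace ℝ (Fin m)} (hy : y ∈ W) :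
    lap G (fun z => F (φ z)) y = lap K F (φ y) ∧
      gradNormSq G (fun z => F (φ z)) y = gradNormSq K F (φ y) := by
  have hφd : ∀ y ∈ W, DifferentiableAt ℝ φ y := fun y hy =>
    (hφ.contDiffAt (hG.isOpen.mem_nhds hy)).differentiableAt (by simp)
  have hJ : ∀ a i, ContDiffOn ℝ ∞ (fun z => jacobian φ z a i) W := fun a i =>
    contDiffOn_pd hG.isOpen (contDiffOn_coord hφ a) i
  -- Invertibility of the Jacobian is not assumed: it follows from nondegeneracy of `G` and the
  -- relation `hGK`.
  have hJdet : ∀ y ∈ W, (jacobian φ y).det ≠ 0 := by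
    intro y hy h0
    apply hG.det_ne_zero hy
    rw [hGK y hy, det_mul, h0, mul_zero]
  let A : Matrix (Fin m) (Fin m) (smoothFun W) := Matrix.of fun a i => mkS _ (hJ a i)
  let Ai : Matrix (Fin m) (Fin m) (smoothFun W) :=
    Matrix.of fun a i => mkS _ (contDiffOn_matrix_inv hJ hJdet a i)
  let Km : Matrix (Fin m) (Fin m) (smoothFun W) :=
    Matrix.of fun a b => mkS (fun z => K (φ z) a b) ((hK.smooth a b).comp hφ hWV)
  let Ki : Matrix (Fin m) (Fin m) (smoothFun W) :=
    Matrix.of fun a b => mkS (fun z => (K (φ z))⁻¹ a b) ((hK.contDiffOn_inv a b).comp hφ hWV)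
  let ΓK : Fin m → Matrix (Fin m) (Fin m) (smoothFun W) := fun i =>
    Matrix.of fun k j => mkS (fun z => christoffel K k j i (φ z))
      ((hK.contDiffOn_christoffel k j i).comp hφ hWV)
  let df : Fin m → smoothFun W := fun a =>
    mkS (fun z => pd a F (φ z)) ((contDiffOn_pd hK.isOpen hF a).comp hφ hWV)
  let ddf : Matrix (Fin m) (Fin m) (smoothFun W) := Matrix.of fun a b =>
    mkS (fun z => pd a (pd b F) (φ z))
      ((contDiffOn_pd hK.isOpen (contDiffOn_pd hK.isOpen hF b) a).comp hφ hWV)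
  let f : smoothFun W := mkS (fun z => F (φ z)) (hF.comp hφ hWV)
  have hGm : hG.mat = Aᵀ * Km * A := by
    refine Matrix.ext fun i j => ext_evS fun z => ?_
    have := congrFun (congrFun (hGK z z.2) i) j
    simp only [IsMetricOn.mat, A, Km, of_apply, mul_apply, transpose_apply, map_sum, map_mul,
      evS_mkS] at this ⊢
    exact this
  have hA : A * Ai = 1 := by
    refine Matrix.ext fun i j => ext_evS fun z => ?_
    have h := congrFun (congrFun (mul_nonsing_inv (jacobian φ z)
      (isUnit_iff_ne_zero.mpr (hJdet z z.2))) i) j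
    rw [mul_apply] at h ⊢
    simp only [map_sum, map_mul, A, Ai, of_apply, evS_mkS]
    rw [h, Matrix.one_apply, Matrix.one_apply]
    split_ifs <;> simp
  have hKi : Ki * Km = 1 := by
    refine Matrix.ext fun i j => ext_evS fun z => ?_
    have h := congrFun (congrFun (nonsing_inv_mul (K (φ z))
      (isUnit_iff_ne_zero.mpr (hK.det_ne_zero (hWV z.2)))) i) j
    rw [mul_apply] at h ⊢
    simp only [map_sum, map_mul, Km, Ki, of_apply, evS_mkS]
    rw [h, Matrix.one_apply, Matrix.one_apply]
    split_ifs <;> simp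
  have hAD : ∀ i j c, derS hG.isOpen i (A c j) = derS hG.isOpen j (A c i) := by
    intro i j c
    simp only [A, of_apply, derS_mkS]
    exact ext_evS fun z => pd_comm hG.isOpen (contDiffOn_coord hφ c) i j z.2
  have htor : ∀ a b c, ΓK a c b = ΓK b c a := fun a b c =>
    ext_evS fun z => hK.christoffel_symm c b a (hWV z.2)
  -- Metric compatibility on `V`, evaluated at `φ z`, combined with the chain rule.
  have hKD : ∀ i, matD (derS hG.isOpen) i Km = ∑ a, A a i • ((ΓK a)ᵀ * Km + Km * ΓK a) := by
    intro i
    refine Matrix.ext fun b c => ext_evS fun z => ?_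
    have h1 : ∀ a, pd a (fun w => K w b c) (φ z) =
        evS z (((ΓK a)ᵀ * Km + Km * ΓK a) b c) := by
      intro a
      have := congrArg (evS (⟨φ z, hWV z.2⟩ : V))
        (congrFun (congrFun (hK.isLeviCivita.compat a) b) c)
      simp only [matD_apply, Matrix.add_apply, mul_apply, transpose_apply, map_add, map_sum,
        map_mul, IsMetricOn.mat, IsMetricOn.conn, of_apply, derS_mkS, evS_mkS] at this
      simp only [Matrix.add_apply, mul_apply, transpose_apply, map_add, map_sum, map_mul, Km, ΓK,
        of_apply, evS_mkS]
      exact this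
    simp only [Matrix.sum_apply, Matrix.smul_apply, smul_eq_mul, map_sum, map_mul, ← h1]
    simp only [matD_apply, Km, A, of_apply, derS_mkS, evS_mkS]
    rw [pd_comp (differentiableAt_of_contDiffOn hK.isOpen (hK.smooth b c) (hWV z.2))
      (hφd z z.2) i]
    exact Finset.sum_congr rfl fun a _ => mul_comm _ _
  have hf : ∀ i, derS hG.isOpen i f = ∑ a, df a * A a i := by
    intro i
    refine ext_evS fun z => ?_
    simp only [f, df, A, of_apply, derS_mkS, map_sum, map_mul, evS_mkS]
    exact pd_comp (differentiableAt_of_contDiffOn hK.isOpen hF (hWV z.2)) (hφd z z.2) i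
  have hdf : ∀ i a, derS hG.isOpen i (df a) = ∑ b, ddf b a * A b i := by
    intro i a
    refine ext_evS fun z => ?_
    simp only [df, ddf, A, of_apply, derS_mkS, map_sum, map_mul, evS_mkS]
    exact pd_comp (differentiableAt_of_contDiffOn hK.isOpen
      (contDiffOn_pd hK.isOpen hF a) (hWV z.2)) (hφd z z.2) i
  have hH := hG.isLeviCivita.hessM_change hGm hA hAD htor hKD hf hdf
  constructor
  · rw [← hG.evS_laplacian (F := fun z => F (φ z)) (hF.comp hφ hWV) ⟨y, hy⟩,
      ← hK.evS_laplacian hF ⟨φ y, hWV hy⟩]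
    change evS _ (trace (hG.matInv * hessM (derS hG.isOpen) hG.conn f)) = _
    rw [hH, hG.isLeviCivita.trace_change hGm hA hKi]
    simp only [trace, diag_apply, mul_apply, map_sum, map_mul, hessM, covVec, of_apply, map_sub,
      derS_mkS, IsMetricOn.matInv, IsMetricOn.conn, evS_mkS, Ki, ddf, df, ΓK]
  · rw [← hG.evS_gradSq (F := fun z => F (φ z)) (hF.comp hφ hWV) ⟨y, hy⟩,
      ← hK.evS_gradSq hF ⟨φ y, hWV hy⟩]
    change evS _ (trace (hG.matInv * vecMulVec (fun l => derS hG.isOpen l f) _)) = _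
    have hv : vecMulVec (fun l => derS hG.isOpen l f) (fun l => derS hG.isOpen l f)
        = Aᵀ * vecMulVec df df * A := by
      refine Matrix.ext fun i j => ?_
      simp only [vecMulVec_apply, hf, mul_apply, transpose_apply, Finset.sum_mul,
        Finset.mul_sum]
      exact Finset.sum_congr rfl fun a _ => Finset.sum_congr rfl fun b _ => by ring
    rw [hv, hG.isLeviCivita.trace_change hGm hA hKi]
    simp only [gradSq, trace, diag_apply, mul_apply, map_sum, map_mul, vecMulVec_apply, derS_mkS,
      IsMetricOn.matInv, of_apply, evS_mkS, Ki, df]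

end Change

end RHSoliton

/-! ### Hopf's strong maximum principle in coordinates -/

namespace RHSoliton

open Matrix

section MaximumPrinciple

/-- Restrict to the line through `y` in direction `w`. A negative second derivative would make the
minimum a local maximum as well, so the restriction would be locally constant and its second
derivative zero. -/
lemma fderiv_fderiv_nonneg_of_isLocalMin {E : Type*} [NormedAddCommGroup E] [NormedSpace ℝ E]
    {v : E → ℝ} {y : E} (hv : ContDiffAt ℝ 2 v y) (hmin : IsLocalMin v y) (w : E) :
    0 ≤ fderiv ℝ (fderiv ℝ v) y w w := by
  by_contra! hneg
  have hline : ∀ t : ℝ, HasDerivAt (fun t : ℝ => y + t • w) w t := fun t => by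
    simpa using ((hasDerivAt_id t).smul_const w).const_add y
  have hcont : Filter.Tendsto (fun t : ℝ => y + t • w) (nhds 0) (nhds y) := by
    simpa using (hline 0).continuousAt.tendsto
  have hd1 : ∀ᶠ z in nhds y, DifferentiableAt ℝ v z :=
    (hv.eventually (by simp)).mono fun z hz => hz.differentiableAt (by simp)
  have hd2 : DifferentiableAt ℝ (fderiv ℝ v) y :=
    (hv.fderiv_right (m := 1) (by norm_num)).differentiableAt (by simp)
  have e1 : deriv (fun t : ℝ => v (y + t • w)) =ᶠ[nhds 0] fun t => fderiv ℝ v (y + t • w) w := by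
    filter_upwards [hcont.eventually hd1] with t ht
    exact (ht.hasFDerivAt.comp_hasDerivAt t (hline t)).deriv
  have e2 : deriv (deriv fun t : ℝ => v (y + t • w)) 0 = fderiv ℝ (fderiv ℝ v) y w w := by
    rw [e1.deriv_eq]
    have h0 : HasFDerivAt (fderiv ℝ v) (fderiv ℝ (fderiv ℝ v) y) (y + (0 : ℝ) • w) := by
      simpa using hd2.hasFDerivAt
    have h1 := h0.comp_hasDerivAt (0 : ℝ) (hline 0)
    have h2 := h1.clm_apply (hasDerivAt_const (0 : ℝ) w)
    simpa using h2.deriv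
  have hmin' : IsLocalMin (fun t : ℝ => v (y + t • w)) 0 := by
    have := hcont.eventually hmin
    simpa [IsLocalMin, IsMinFilter] using this
  have hmax : IsLocalMax (fun t : ℝ => v (y + t • w)) 0 := by
    refine isLocalMax_of_deriv_deriv_neg (by rwa [e2]) hmin'.deriv_eq_zero ?_
    have hc : ContinuousAt v (y + (0 : ℝ) • w) := by simpa using hv.continuousAt
    exact ContinuousAt.comp (f := fun t : ℝ => y + t • w) hc (hline 0).continuousAt
  have hconst : (fun t : ℝ => v (y + t • w)) =ᶠ[nhds 0] fun _ => v (y + (0 : ℝ) • w) := by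
    filter_upwards [hmin', hmax] with t h1 h2 using le_antisymm h2 h1
  have : deriv (deriv fun t : ℝ => v (y + t • w)) 0 = 0 := by
    rw [hconst.deriv.deriv_eq]; simp
  rw [e2] at this
  exact hneg.ne this

variable {m : ℕ} {W : Set (EuclideanSpace ℝ (Fin m))}
  {G : EuclideanSpace ℝ (Fin m) → Matrix (Fin m) (Fin m) ℝ}

lemma pd_eq_zero_of_isLocalMin {v : EuclideanSpace ℝ (Fin m) → ℝ} {y : EuclideanSpace ℝ (Fin m)}
    (hmin : IsLocalMin v y) (i : Fin m) : pd i v y = 0 := by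
  rw [pd, hmin.fderiv_eq_zero]; rfl

/-- Writing `A = CᵀC` turns the trace into a sum of values of the quadratic form of `B` on the rows
of `C`. -/
lemma trace_mul_nonneg {A B : Matrix (Fin m) (Fin m) ℝ} (hA : A.PosSemidef)
    (hB : ∀ w : Fin m → ℝ, 0 ≤ ∑ i, ∑ j, w i * w j * B i j) : 0 ≤ ∑ i, ∑ j, A i j * B i j := by
  open scoped MatrixOrder in
  obtain ⟨C, rfl⟩ := CStarAlgebra.nonneg_iff_eq_star_mul_self.mp hA.nonneg
  have : ∑ i, ∑ j, (star C * C) i j * B i j = ∑ k, ∑ i, ∑ j, C k i * C k j * B i j := by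
    simp only [mul_apply, star_eq_conjTranspose, conjTranspose_apply, star_trivial, Finset.sum_mul]
    rw [Finset.sum_congr rfl fun i _ => Finset.sum_comm]
    exact Finset.sum_comm
  rw [this]
  exact Finset.sum_nonneg fun k _ => hB (C k)

namespace IsMetricOn

variable (hG : IsMetricOn G W)
include hG

/-- At a critical point the Christoffel terms drop out, leaving the trace of a positive semidefinite
second derivative against the inverse metric. -/
lemma lap_nonneg_of_isLocalMin {v : EuclideanSpace ℝ (Fin m) → ℝ} (hv : ContDiffOn ℝ ∞ v W)
    {y : EuclideanSpace ℝ (Fin m)} (hy : y ∈ W) (hmin : IsLocalMin v y) : 0 ≤ lap G v y := by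
  have hvy : ContDiffAt ℝ ∞ v y := hv.contDiffAt (hG.isOpen.mem_nhds hy)
  refine trace_mul_nonneg (hG.posDef y hy).inv.posSemidef fun w => ?_
  have h1 : ∀ i j, hess G v i j y =
      fderiv ℝ (fderiv ℝ v) y (EuclideanSpace.single i 1) (EuclideanSpace.single j 1) := by
    intro i j
    rw [hess, pd_pd hG.isOpen hv i j hy]
    simp [pd_eq_zero_of_isLocalMin hmin]
  have h2 := fderiv_fderiv_nonneg_of_isLocalMin
    (hvy.of_le (by simpa using ENat.LEInfty.out)) hmin
    (∑ i, w i • EuclideanSpace.single i (1 : ℝ))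
  simp only [map_sum, map_smul, _root_.sum_apply, _root_.smul_apply,
    smul_eq_mul, ← h1, Finset.mul_sum] at h2
  rw [Finset.sum_comm] at h2
  refine h2.trans_eq (Finset.sum_congr rfl fun i _ => Finset.sum_congr rfl fun j _ => ?_)
  ring

lemma lap_add_smul {v w : EuclideanSpace ℝ (Fin m) → ℝ} (hv : ContDiffOn ℝ ∞ v W)
    (hw : ContDiffOn ℝ ∞ w W) (r : ℝ) {y : EuclideanSpace ℝ (Fin m)} (hy : y ∈ W) :
    lap G (fun z => v z + r * w z) y = lap G v y + r * lap G w y := by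
  rw [← hG.evS_laplacian hv ⟨y, hy⟩, ← hG.evS_laplacian hw ⟨y, hy⟩,
    ← hG.evS_laplacian (F := fun z => v z + r * w z) (hv.add (contDiffOn_const.mul hw)) ⟨y, hy⟩]
  have e : mkS (fun z => v z + r * w z) (hv.add (contDiffOn_const.mul hw))
      = mkS v hv + r • mkS w hw := ext_evS fun z => by
    rw [map_add, map_smul]; rfl
  have e2 : hessM (derS hG.isOpen) hG.conn (mkS v hv + r • mkS w hw)
      = hessM (derS hG.isOpen) hG.conn (mkS v hv) + r • hessM (derS hG.isOpen) hG.conn (mkS w hw) := by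
    refine Matrix.ext fun i j => ?_
    simp only [hessM, covVec, of_apply, Matrix.add_apply, Matrix.smul_apply, map_add,
      Derivation.map_smul, add_mul, Finset.sum_add_distrib, smul_mul_assoc, ← Finset.smul_sum,
      smul_sub]
    abel
  rw [e, e2, mul_add, trace_add, mul_smul_comm, trace_smul, map_add, map_smul, smul_eq_mul]

lemma lap_mul_self {v : EuclideanSpace ℝ (Fin m) → ℝ} (hv : ContDiffOn ℝ ∞ v W)
    {y : EuclideanSpace ℝ (Fin m)} (hy : y ∈ W) :
    lap G (fun z => v z * v z) y = 2 * v y * lap G v y + 2 * gradNormSq G v y := by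
  rw [← hG.evS_laplacian hv ⟨y, hy⟩, ← hG.evS_gradSq hv ⟨y, hy⟩,
    ← hG.evS_laplacian (F := fun z => v z * v z) (hv.mul hv) ⟨y, hy⟩]
  set f := mkS v hv with hf
  have e : mkS (fun z => v z * v z) (hv.mul hv) = f * f := rfl
  have e2 : hessM (derS hG.isOpen) hG.conn (f * f)
      = (2 * f) • hessM (derS hG.isOpen) hG.conn f +
        (2 : smoothFun W) • vecMulVec (fun l => derS hG.isOpen l f) (fun l => derS hG.isOpen l f) := by
    refine Matrix.ext fun i j => ?_
    simp only [hessM, covVec, of_apply, Matrix.add_apply, Matrix.smul_apply, map_add,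
      Derivation.leibniz, smul_eq_mul, vecMulVec_apply, mul_sub, Finset.mul_sum]
    have : ∑ x, (f * derS hG.isOpen x f + f * derS hG.isOpen x f) * hG.conn i x j
        = ∑ x, 2 * f * (derS hG.isOpen x f * hG.conn i x j) :=
      Finset.sum_congr rfl fun x _ => by ring
    rw [this]; ring
  rw [e, e2, mul_add, trace_add, mul_smul_comm, trace_smul, mul_smul_comm, trace_smul, map_add,
    gradSq, smul_eq_mul, smul_eq_mul, map_mul, map_mul, map_mul, map_ofNat]
  rfl

lemma contDiffOn_lap {v : EuclideanSpace ℝ (Fin m) → ℝ} (hv : ContDiffOn ℝ ∞ v W) :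
    ContDiffOn ℝ ∞ (lap G v) W := by
  obtain ⟨F, hF, h⟩ := exists_mkS (trace (hG.matInv * hessM (derS hG.isOpen) hG.conn (mkS v hv)))
  refine hF.congr fun y hy => ?_
  rw [← hG.evS_laplacian hv ⟨y, hy⟩, h, evS_mkS]

lemma gradNormSq_pos {v : EuclideanSpace ℝ (Fin m) → ℝ} {y : EuclideanSpace ℝ (Fin m)}
    (hy : y ∈ W) (h : fderiv ℝ v y ≠ 0) : 0 < gradNormSq G v y := by
  have hne : (fun i => pd i v y) ≠ 0 := by
    intro h0
    apply h
    ext w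
    rw [fderiv_eq_sum_pd]
    exact Finset.sum_eq_zero fun e _ => by rw [congrFun h0 e]; simp
  have := (hG.posDef y hy).inv.dotProduct_mulVec_pos hne
  simp only [dotProduct, mulVec, Pi.star_apply, star_trivial, Finset.mul_sum] at this
  refine this.trans_eq (Finset.sum_congr rfl fun i _ => Finset.sum_congr rfl fun j _ => by ring)

/-- A barrier function at a point `z` of the sphere with centre `q`. -/
lemma exists_barrier {z q : EuclideanSpace ℝ (Fin m)} (hz : z ∈ W) (hq : z ≠ q) :
    ∃ A : ℝ, 0 < A ∧ ∃ δ > 0, Metric.closedBall z δ ⊆ W ∧ ∀ x ∈ Metric.closedBall z δ,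
      A * (‖x - q‖ ^ 2 - ‖z - q‖ ^ 2) < 1 ∧
      0 < lap G (fun x => -(‖x - q‖ ^ 2 - ‖z - q‖ ^ 2) +
        A * ((‖x - q‖ ^ 2 - ‖z - q‖ ^ 2) * (‖x - q‖ ^ 2 - ‖z - q‖ ^ 2))) x := by
  set t : EuclideanSpace ℝ (Fin m) → ℝ := fun x => ‖x - q‖ ^ 2 - ‖z - q‖ ^ 2 with ht
  have htc : ContDiff ℝ ∞ t := ((contDiff_id.sub contDiff_const).norm_sq ℝ).sub contDiff_const
  have htW : ContDiffOn ℝ ∞ t W := htc.contDiffOn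
  have hgrad : 0 < gradNormSq G t z := by
    refine hG.gradNormSq_pos hz fun h0 => ?_
    have h1 : HasFDerivAt t (2 • (innerSL ℝ (z - q)).comp
        (ContinuousLinearMap.id ℝ (EuclideanSpace ℝ (Fin m)))) z :=
      (((hasFDerivAt_id z).sub_const q).norm_sq).sub_const _
    rw [h1.fderiv] at h0
    have h2 : (2 : ℕ) • inner ℝ (z - q) (z - q) = 0 := congrArg (fun L => L (z - q)) h0
    rw [nsmul_eq_mul, mul_eq_zero, inner_self_eq_zero, sub_eq_zero] at h2
    exact h2.elim (by norm_num) hq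
  -- Since `t z = 0`, the barrier `-t + A t²` has Laplacian `-Δt + 2A|∇t|²` at `z`. As `∇t` does not
  -- vanish there, a large `A` makes this positive; continuity extends it to a small ball.
  obtain ⟨A, hA0, hA⟩ : ∃ A : ℝ, 0 < A ∧ lap G t z < 2 * A * gradNormSq G t z := by
    refine ⟨(|lap G t z| + 1) / (2 * gradNormSq G t z), by positivity, ?_⟩
    have : 2 * ((|lap G t z| + 1) / (2 * gradNormSq G t z)) * gradNormSq G t z
        = |lap G t z| + 1 := by field_simp
    rw [this]
    linarith [le_abs_self (lap G t z)]
  set w : EuclideanSpace ℝ (Fin m) → ℝ := fun x => -t x + A * (t x * t x) with hw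
  have hwW : ContDiffOn ℝ ∞ w W := htW.neg.add (contDiffOn_const.mul (htW.mul htW))
  have htz : t z = 0 := by simp [ht]
  have hneg : lap G (fun x => -t x) z = - lap G t z := by
    have h1 := hG.lap_add_smul (v := fun x => t x) (w := t) htW htW (-2) hz
    have e : (fun x => t x + -2 * t x) = fun x => -t x := by funext x; ring
    rw [e] at h1
    rw [h1]; ring
  have hwz : 0 < lap G w z := by
    rw [hw, hG.lap_add_smul (v := fun x => -t x) htW.neg (htW.mul htW) A hz,
      hG.lap_mul_self htW hz, hneg, htz]
    linarith
  have hc1 : ∀ᶠ x in nhds z, 0 < lap G w x :=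
    ((hG.contDiffOn_lap hwW).continuousOn.continuousAt (hG.isOpen.mem_nhds hz)).eventually
      (lt_mem_nhds hwz)
  have hc2 : ∀ᶠ x in nhds z, A * t x < 1 := by
    refine (continuous_const.mul htc.continuous).continuousAt.eventually (gt_mem_nhds ?_)
    change A * t z < 1
    rw [htz]; simp
  obtain ⟨δ, hδ, h⟩ := Metric.nhds_basis_closedBall.eventually_iff.mp
    ((hc1.and hc2).and (hG.isOpen.mem_nhds hz))
  exact ⟨A, hA0, δ, hδ, fun x hx => (h hx).2, fun x hx => ⟨(h hx).1.2, (h hx).1.1⟩⟩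

/-- A superharmonic function attaining its minimum `M` at the boundary point `z` of a ball on whose
closure minus `z` it is larger than `M` does not exist near `z`. -/
lemma not_touching_ball {v : EuclideanSpace ℝ (Fin m) → ℝ} (hv : ContDiffOn ℝ ∞ v W)
    (hlap : ∀ y ∈ W, lap G v y ≤ 0) {M : ℝ} (hM : ∀ y ∈ W, M ≤ v y)
    {z q : EuclideanSpace ℝ (Fin m)} (hz : z ∈ W) (hzM : v z = M) (hq : z ≠ q)
    (hball : ∀ x ∈ W, x ≠ z → ‖x - q‖ ≤ ‖z - q‖ → v x ≠ M) : False := by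
  obtain ⟨A, hA, δ, hδ, hsub, hbar⟩ := hG.exists_barrier hz hq
  set t : EuclideanSpace ℝ (Fin m) → ℝ := fun x => ‖x - q‖ ^ 2 - ‖z - q‖ ^ 2 with ht
  set w : EuclideanSpace ℝ (Fin m) → ℝ := fun x => -t x + A * (t x * t x) with hw
  have htc : ContDiff ℝ ∞ t := ((contDiff_id.sub contDiff_const).norm_sq ℝ).sub contDiff_const
  have hwc : ContDiff ℝ ∞ w := htc.neg.add (contDiff_const.mul (htc.mul htc))
  have htz : t z = 0 := by simp [ht]
  have hwz : w z = 0 := by simp [hw, htz]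
  have hvc : ContinuousOn v (Metric.closedBall z δ) := hv.continuousOn.mono hsub
  -- The part of the small sphere in the touching ball is compact and misses `z`, so `v` exceeds `M`
  -- by a definite amount there; this leaves room for a small multiple of `w`.
  set S := Metric.sphere z δ ∩ Metric.closedBall q ‖z - q‖ with hS
  have hSc : IsCompact S := (isCompact_sphere z δ).inter_right Metric.isClosed_closedBall
  have hSsub : S ⊆ Metric.closedBall z δ := fun x hx => Metric.sphere_subset_closedBall hx.1
  obtain ⟨ε, hε, hεS⟩ : ∃ ε > 0, ∀ x ∈ S, M < v x - ε * w x := by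
    rcases S.eq_empty_or_nonempty with h0 | hne
    · exact ⟨1, one_pos, by simp [h0]⟩
    · obtain ⟨x1, hx1, h1⟩ := hSc.exists_isMinOn hne (hvc.mono hSsub)
      obtain ⟨x2, hx2, h2⟩ := hSc.exists_isMaxOn hne hwc.continuous.continuousOn
      have hx1z : x1 ≠ z := by
        rintro rfl
        have := hx1.1
        simp at this
        exact hδ.ne this
      have hη : 0 < v x1 - M := by
        have h3 := hM x1 (hsub (hSsub hx1))
        have h4 := hball x1 (hsub (hSsub hx1)) hx1z (by simpa [dist_eq_norm] using hx1.2)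
        exact sub_pos.mpr (lt_of_le_of_ne h3 (Ne.symm h4))
      refine ⟨(v x1 - M) / (|w x2| + 1), by positivity, fun x hx => ?_⟩
      have h5 : v x1 ≤ v x := h1 hx
      have h6 : w x ≤ |w x2| := (h2 hx : w x ≤ w x2).trans (le_abs_self _)
      have h7 : (v x1 - M) / (|w x2| + 1) * w x < v x1 - M := by
        rw [div_mul_eq_mul_div, div_lt_iff₀ (by positivity)]
        exact mul_lt_mul_of_pos_left (by linarith) hη
      linarith
  -- On the rest of the sphere `t > 0` and `A t < 1`, so `w = t (A t - 1)` is negative and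
  -- subtracting `ε w` raises `v`.
  have hsphere : ∀ x ∈ Metric.sphere z δ, M < v x - ε * w x := by
    intro x hx
    by_cases hxq : x ∈ Metric.closedBall q ‖z - q‖
    · exact hεS x ⟨hx, hxq⟩
    · have hx' := Metric.sphere_subset_closedBall hx
      have h1 : 0 < t x := by
        rw [Metric.mem_closedBall, dist_eq_norm, not_le] at hxq
        have := pow_lt_pow_left₀ hxq (norm_nonneg _) two_ne_zero
        simp only [ht]; linarith
      have h2 : w x < 0 := by
        have : w x = t x * (A * t x - 1) := by simp only [hw]; ring
        rw [this]
        exact mul_neg_of_pos_of_neg h1 (sub_neg.mpr (hbar x hx').1)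
      have h3 := hM x (hsub hx')
      have h4 := mul_neg_of_pos_of_neg hε h2
      linarith
  obtain ⟨p, hp, hpmin⟩ := (isCompact_closedBall z δ).exists_isMinOn
    ⟨z, Metric.mem_closedBall_self hδ.le⟩
    (hvc.sub (continuousOn_const.mul hwc.continuous.continuousOn) :
      ContinuousOn (fun x => v x - ε * w x) (Metric.closedBall z δ))
  have hpM : v p - ε * w p ≤ M := by
    have := hpmin (Metric.mem_closedBall_self hδ.le)
    simpa [hwz, hzM] using this
  have hpball : p ∈ Metric.ball z δ := by
    refine Metric.mem_ball.mpr (lt_of_le_of_ne (Metric.mem_closedBall.mp hp) fun h => ?_)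
    exact absurd (hsphere p h) (not_lt.mpr hpM)
  -- The value at `z` is `M`, below all boundary values, so the minimum is interior and the
  -- Laplacian there is nonnegative; but `Δv ≤ 0` and `Δw > 0`.
  have hloc : IsLocalMin (fun x => v x + -ε * w x) p := by
    filter_upwards [Metric.isOpen_ball.mem_nhds hpball] with x hx
    have h1 : v p - ε * w p ≤ v x - ε * w x := hpmin (Metric.ball_subset_closedBall hx)
    linarith
  have h1 := hG.lap_nonneg_of_isLocalMin (hv.add (contDiffOn_const.mul hwc.contDiffOn))
    (hsub hp) hloc
  rw [hG.lap_add_smul hv hwc.contDiffOn (-ε) (hsub hp)] at h1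
  have h2 := hlap p (hsub hp)
  have h3 := mul_pos hε (hbar p hp).2
  linarith

/-- Hopf's strong maximum principle, local form. -/
theorem eventually_eq_of_lap_nonpos {v : EuclideanSpace ℝ (Fin m) → ℝ} (hv : ContDiffOn ℝ ∞ v W)
    (hlap : ∀ y ∈ W, lap G v y ≤ 0) {M : ℝ} (hM : ∀ y ∈ W, M ≤ v y)
    {x₀ : EuclideanSpace ℝ (Fin m)} (hx₀ : x₀ ∈ W) (hx₀M : v x₀ = M) :
    ∀ᶠ y in nhds x₀, v y = M := by
  obtain ⟨ρ, hρ, hρW⟩ := Metric.isOpen_iff.mp hG.isOpen x₀ hx₀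
  -- Half the radius ensures that the closed ball about `y` through `x₀` stays in `W`.
  filter_upwards [Metric.ball_mem_nhds x₀ (half_pos hρ)] with y hy
  by_contra hyM
  have hsub : Metric.closedBall y (dist x₀ y) ⊆ W := by
    intro x hx
    apply hρW
    rw [Metric.mem_ball] at hy ⊢
    rw [Metric.mem_closedBall] at hx
    calc dist x x₀ ≤ dist x y + dist y x₀ := dist_triangle _ _ _
      _ < ρ := by rw [dist_comm x₀ y] at hx; linarith
  set K := Metric.closedBall y (dist x₀ y) ∩ v ⁻¹' {M} with hK
  have hKc : IsCompact K := by
    have : IsClosed K := (hv.continuousOn.mono hsub).preimage_isClosed_of_isClosed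
      Metric.isClosed_closedBall isClosed_singleton
    exact (isCompact_closedBall y (dist x₀ y)).of_isClosed_subset this Set.inter_subset_left
  obtain ⟨z, hz, hzmin⟩ := hKc.exists_isMinOn ⟨x₀, by simp [hK, hx₀M]⟩
    (f := fun x => dist x y) (continuous_id.dist continuous_const).continuousOn
  have hzy : z ≠ y := by rintro rfl; exact hyM hz.2
  -- Here `z` is a point of `{v = M}` nearest to `y` within that ball. The ball centred at the
  -- midpoint `q` of `y` and `z` is internally tangent at `z`, so its other points are strictly
  -- closer to `y`, as the parallelogram law shows, and `v ≠ M` on them.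
  set q : EuclideanSpace ℝ (Fin m) := (1 / 2 : ℝ) • (y + z) with hq
  have hzq : z - q = (1 / 2 : ℝ) • (z - y) := by rw [hq]; module
  have hqy : q - y = (1 / 2 : ℝ) • (z - y) := by rw [hq]; module
  refine hG.not_touching_ball hv hlap hM (hsub hz.1) hz.2 (q := q) ?_ ?_
  · intro h
    rw [← sub_eq_zero, hzq, smul_eq_zero, sub_eq_zero] at h
    exact h.elim (by norm_num) hzy
  · intro x hx hxz hxq hxM
    have hpar := parallelogram_law_with_norm ℝ (x - q) (z - q)
    have e1 : x - q + (z - q) = x - y := by rw [hzq, ← hqy]; abel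
    have e2 : x - q - (z - q) = x - z := by abel
    have e3 : ‖z - y‖ = 2 * ‖z - q‖ := by
      rw [hzq, norm_smul, Real.norm_of_nonneg (by norm_num)]; ring
    rw [e1, e2] at hpar
    have h1 : 0 < ‖x - z‖ := norm_pos_iff.mpr (sub_ne_zero.mpr hxz)
    have h2 : ‖x - y‖ < ‖z - y‖ := by
      rw [e3]
      nlinarith [norm_nonneg (x - y), norm_nonneg (x - q), norm_nonneg (z - q)]
    have hxK : x ∈ K := by
      refine ⟨?_, hxM⟩
      rw [Metric.mem_closedBall]
      have : dist z y ≤ dist x₀ y := hz.1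
      rw [dist_eq_norm] at this ⊢
      exact h2.le.trans this
    have h3 : dist z y ≤ dist x y := hzmin hxK
    rw [dist_eq_norm, dist_eq_norm] at h3
    exact absurd h2 (not_lt.mpr h3)

end IsMetricOn

end MaximumPrinciple

end RHSoliton

/-! ### Metric components in charts and their transformation -/

namespace RHSoliton

open Matrix Bundle

section Manifold

variable {m : ℕ}
  {M : Type*} [TopologicalSpace M] [ChartedSpace (EuclideanSpace ℝ (Fin m)) M]
  [IsManifold (𝓡 m) ∞ M]

/-- The derivative of the inverse chart, as a map between model spaces. -/
noncomputable def chartFrame (p : M) (y : EuclideanSpace ℝ (Fin m)) :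
    EuclideanSpace ℝ (Fin m) →L[ℝ] EuclideanSpace ℝ (Fin m) :=
  mfderiv 𝓘(ℝ, EuclideanSpace ℝ (Fin m)) (𝓡 m) (extChartAt (𝓡 m) p).symm y

/-- The metric at a point as a bilinear form on the model space. -/
def modelForm (g : RMetric m M) (x : M) :
    EuclideanSpace ℝ (Fin m) →L[ℝ] EuclideanSpace ℝ (Fin m) →L[ℝ] ℝ := g.inner x

/-- Tangent spaces are definitionally the model space; dropping the base point from the types lets
frames of different charts be compared. -/
lemma gCoord_apply (g : RMetric m M) (p : M) (y : EuclideanSpace ℝ (Fin m)) (i j : Fin m) :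
    gCoord g p y i j = modelForm g ((extChartAt (𝓡 m) p).symm y)
      (chartFrame p y (EuclideanSpace.single i 1)) (chartFrame p y (EuclideanSpace.single j 1)) :=
  rfl

lemma modelForm_sum_left (g : RMetric m M) (x : M) {ι : Type*} (s : Finset ι) (c : ι → ℝ)
    (v : ι → EuclideanSpace ℝ (Fin m)) (w : EuclideanSpace ℝ (Fin m)) :
    modelForm g x (∑ a ∈ s, c a • v a) w = ∑ a ∈ s, c a * modelForm g x (v a) w := by
  simp only [map_sum, map_smul, _root_.sum_apply, _root_.smul_apply, smul_eq_mul]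

lemma modelForm_symm (g : RMetric m M) (x : M) (v w : EuclideanSpace ℝ (Fin m)) :
    modelForm g x v w = modelForm g x w v := g.symm x v w

lemma modelForm_sum_sum (g : RMetric m M) (x : M) (c d : Fin m → ℝ)
    (v : Fin m → EuclideanSpace ℝ (Fin m)) :
    modelForm g x (∑ a, c a • v a) (∑ b, d b • v b) =
      ∑ a, ∑ b, c a * modelForm g x (v a) (v b) * d b := by
  rw [modelForm_sum_left]
  refine Finset.sum_congr rfl fun a _ => ?_
  rw [modelForm_symm, modelForm_sum_left, Finset.mul_sum]
  exact Finset.sum_congr rfl fun b _ => by rw [modelForm_symm]; ring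

lemma isOpen_target (p : M) : IsOpen (extChartAt (𝓡 m) p).target := isOpen_extChartAt_target p

lemma chartFrame_injective {p : M} {y : EuclideanSpace ℝ (Fin m)}
    (hy : y ∈ (extChartAt (𝓡 m) p).target) : Function.Injective (chartFrame p y) := by
  have h := isInvertible_mfderivWithin_extChartAt_symm (I := 𝓡 m) (x := p) hy
  rw [ModelWithCorners.range_eq_univ, mfderivWithin_univ] at h
  exact h.injective

/-- Coordinate fields are smooth because they are the tangent map of the inverse chart applied to a
constant field; the smooth metric is then evaluated on two of them. -/
lemma contDiffOn_gCoord (g : RMetric m M) (p : M) (i j : Fin m) :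
    ContDiffOn ℝ ∞ (fun z => gCoord g p z i j) (extChartAt (𝓡 m) p).target := by
  set s := (extChartAt (𝓡 m) p).target
  have hs : IsOpen s := isOpen_target p
  have hsymm : ContMDiffOn 𝓘(ℝ, EuclideanSpace ℝ (Fin m)) (𝓡 m) ∞ (extChartAt (𝓡 m) p).symm s :=
    contMDiffOn_extChartAt_symm p
  have hvec : ∀ i : Fin m, ContMDiffOn 𝓘(ℝ, EuclideanSpace ℝ (Fin m)) ((𝓡 m).prod 𝓘(ℝ, EuclideanSpace ℝ (Fin m))) ∞
      (fun z => TotalSpace.mk' (EuclideanSpace ℝ (Fin m)) (E := fun x : M => TangentSpace (𝓡 m) x)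
        ((extChartAt (𝓡 m) p).symm z) (coordVec p i z)) s := by
    intro i
    have h1 := hsymm.contMDiffOn_tangentMapWithin (m := ∞) (by simp) hs.uniqueMDiffOn
    have h2 : ContMDiff 𝓘(ℝ, EuclideanSpace ℝ (Fin m)) 𝓘(ℝ, EuclideanSpace ℝ (Fin m)).tangent ∞
        (fun z : EuclideanSpace ℝ (Fin m) => (⟨z, EuclideanSpace.single i 1⟩ :
          TangentBundle 𝓘(ℝ, EuclideanSpace ℝ (Fin m)) (EuclideanSpace ℝ (Fin m)))) := by
      exact contMDiff_vectorSpace_iff_contDiff.mpr contDiff_const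
    have h3 := h1.comp h2.contMDiffOn (s := s) (fun z hz => hz)
    refine h3.congr fun z hz => ?_
    simp only [Function.comp, tangentMapWithin, mfderivWithin_of_isOpen hs hz]
    rfl
  rw [← contMDiffOn_iff_contDiffOn]
  intro x hx
  have : ContMDiffWithinAt 𝓘(ℝ, EuclideanSpace ℝ (Fin m)) ((𝓡 m).prod 𝓘(ℝ)) ∞
      (fun z ↦ TotalSpace.mk' ℝ (E := Bundle.Trivial M ℝ) ((extChartAt (𝓡 m) p).symm z)
        (g.inner _ (coordVec p i z) (coordVec p j z))) s x := by
    apply ContMDiffWithinAt.clm_bundle_apply₂ (F₁ := EuclideanSpace ℝ (Fin m))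
      (F₂ := EuclideanSpace ℝ (Fin m))
    · exact ContMDiffAt.comp_contMDiffWithinAt x g.contMDiff.contMDiffAt (hsymm x hx)
    · exact hvec i x hx
    · exact hvec j x hx
  simp only [contMDiffWithinAt_totalSpace] at this
  exact this.2

theorem isMetricOn_gCoord (g : RMetric m M) (p : M) :
    IsMetricOn (gCoord g p) (extChartAt (𝓡 m) p).target where
  isOpen := isOpen_target p
  smooth := contDiffOn_gCoord g p
  posDef y hy := by
    refine PosDef.of_dotProduct_mulVec_pos ?_ fun c hc => ?_
    · ext i j
      simpa [gCoord_apply] using modelForm_symm g _ _ _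
    · set v : EuclideanSpace ℝ (Fin m) := ∑ a, c a • EuclideanSpace.single a (1 : ℝ) with hv
      have hv0 : v ≠ 0 := by
        intro h0
        apply hc
        funext j
        have := congrArg (fun w : EuclideanSpace ℝ (Fin m) => w j) h0
        simpa [hv, Finset.sum_apply, Pi.single_apply] using this
      have h1 : chartFrame p y v ≠ 0 := fun h0 =>
        hv0 (chartFrame_injective hy (h0.trans (map_zero _).symm))
      have h2 : 0 < modelForm g ((extChartAt (𝓡 m) p).symm y) (chartFrame p y v)
        (chartFrame p y v) := g.pos _ _ h1
      rw [hv, map_sum] at h2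
      simp only [map_smul] at h2
      rw [modelForm_sum_sum] at h2
      refine h2.trans_eq ?_
      simp only [dotProduct, mulVec, Pi.star_apply, star_trivial, Finset.mul_sum, gCoord_apply]
      exact Finset.sum_congr rfl fun a _ => Finset.sum_congr rfl fun b _ => by ring

/-- The coordinate change between the charts around `p` and `q`. -/
noncomputable def chartChange (p q : M) (y : EuclideanSpace ℝ (Fin m)) :
    EuclideanSpace ℝ (Fin m) :=
  extChartAt (𝓡 m) q ((extChartAt (𝓡 m) p).symm y)

/-- The domain of the coordinate change. -/
def overlap (p q : M) : Set (EuclideanSpace ℝ (Fin m)) :=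
  (extChartAt (𝓡 m) p).target ∩ (extChartAt (𝓡 m) p).symm ⁻¹' (extChartAt (𝓡 m) q).source

lemma isOpen_overlap (p q : M) : IsOpen (overlap (m := m) p q) :=
  (continuousOn_extChartAt_symm p).isOpen_inter_preimage (isOpen_target p)
    (isOpen_extChartAt_source q)

lemma contDiffOn_chartChange (p q : M) : ContDiffOn ℝ ∞ (chartChange (m := m) p q) (overlap p q) := by
  have h := contDiffOn_ext_coord_change (I := 𝓡 m) (n := ∞) q p
  refine h.mono fun y hy => ?_
  rw [PartialEquiv.trans_source]
  exact hy

/-- Differentiating the factorisation of one inverse chart through the other expresses the frame of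
`p` by the Jacobian in the frame of `q`; bilinearity does the rest. -/
lemma gCoord_change (g : RMetric m M) (p q : M) {y : EuclideanSpace ℝ (Fin m)}
    (hy : y ∈ overlap p q) :
    gCoord g p y = (jacobian (chartChange p q) y)ᵀ * gCoord g q (chartChange p q y) *
      jacobian (chartChange p q) y := by
  set φ := chartChange (m := m) p q with hφ
  have hφd : DifferentiableAt ℝ φ y :=
    ((contDiffOn_chartChange p q).contDiffAt
      ((isOpen_overlap p q).mem_nhds hy)).differentiableAt (by simp)
  have hpt : ∀ z ∈ overlap p q, (extChartAt (𝓡 m) q).symm (φ z) = (extChartAt (𝓡 m) p).symm z :=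
    fun z hz => (extChartAt (𝓡 m) q).left_inv hz.2
  have hφt : φ y ∈ (extChartAt (𝓡 m) q).target := (extChartAt (𝓡 m) q).map_source hy.2
  have hframe : ∀ v, chartFrame p y v = chartFrame q (φ y) (fderiv ℝ φ y v) := by
    have h1 : (extChartAt (𝓡 m) p).symm =ᶠ[nhds y] (extChartAt (𝓡 m) q).symm ∘ φ :=
      Filter.eventuallyEq_of_mem ((isOpen_overlap p q).mem_nhds hy) fun z hz => (hpt z hz).symm
    have h2 : MDifferentiableAt 𝓘(ℝ, EuclideanSpace ℝ (Fin m)) (𝓡 m) (extChartAt (𝓡 m) q).symm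
        (φ y) :=
      ((contMDiffOn_extChartAt_symm (n := ∞) q).contMDiffAt
        ((isOpen_target q).mem_nhds hφt)).mdifferentiableAt (by simp)
    have h3 := h1.mfderiv_eq (I := 𝓘(ℝ, EuclideanSpace ℝ (Fin m))) (I' := 𝓡 m)
    have h4 := mfderiv_comp y h2 hφd.mdifferentiableAt
    rw [mfderiv_eq_fderiv] at h4
    intro v
    have h5 := h3.trans h4
    exact DFunLike.congr_fun h5 v
  have hsum : ∀ i, fderiv ℝ φ y (EuclideanSpace.single i 1) =
      ∑ a, jacobian φ y a i • EuclideanSpace.single a (1 : ℝ) := by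
    intro i
    ext j
    have h2 : pd i (fun z => φ z j) y = fderiv ℝ φ y (EuclideanSpace.single i 1) j := by
      have : (fun z => φ z j) = (EuclideanSpace.proj (𝕜 := ℝ) j) ∘ φ := rfl
      rw [pd, this, fderiv_comp y (ContinuousLinearMap.differentiableAt _) hφd,
        ContinuousLinearMap.fderiv]
      rfl
    rw [← h2]
    simp [Finset.sum_apply, Pi.single_apply, jacobian]
  have hsum' : ∀ i, chartFrame q (φ y) (fderiv ℝ φ y (EuclideanSpace.single i 1)) =
      ∑ a, jacobian φ y a i • chartFrame q (φ y) (EuclideanSpace.single a (1 : ℝ)) := by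
    intro i
    rw [hsum, map_sum]
    simp only [map_smul]
  ext i j
  rw [gCoord_apply, hframe, hframe, hsum', hsum', modelForm_sum_sum, ← hpt y hy]
  simp only [mul_apply, transpose_apply, Finset.sum_mul, gCoord_apply]
  rw [Finset.sum_comm]

end Manifold

end RHSoliton

/-! ### Compact manifolds: the maximum principle and Hamilton's identity -/

namespace RHSoliton

open Matrix

section Coordinates

variable {m : ℕ} {W : Set (EuclideanSpace ℝ (Fin m))}
  {G : EuclideanSpace ℝ (Fin m) → Matrix (Fin m) (Fin m) ℝ}

lemma lap_congr (hW : IsOpen W) {F F' : EuclideanSpace ℝ (Fin m) → ℝ}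
    (h : ∀ y ∈ W, F y = F' y) {y : EuclideanSpace ℝ (Fin m)} (hy : y ∈ W) :
    lap G F y = lap G F' y := by
  have h1 := pd_congr hW h
  simp only [lap, hess, h1 _ y hy, pd_congr hW (h1 _) _ y hy]

lemma gradNormSq_congr (hW : IsOpen W) {F F' : EuclideanSpace ℝ (Fin m) → ℝ}
    (h : ∀ y ∈ W, F y = F' y) {y : EuclideanSpace ℝ (Fin m)} (hy : y ∈ W) :
    gradNormSq G F y = gradNormSq G F' y := by
  simp only [gradNormSq, pd_congr hW h _ y hy]

namespace IsMetricOn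

variable (hG : IsMetricOn G W)
include hG

lemma mono {W' : Set (EuclideanSpace ℝ (Fin m))} (hW' : IsOpen W') (h : W' ⊆ W) :
    IsMetricOn G W' :=
  ⟨hW', fun i j => (hG.smooth i j).mono h, fun z hz => hG.posDef z (h hz)⟩

lemma gradNormSq_nonneg (v : EuclideanSpace ℝ (Fin m) → ℝ) {y : EuclideanSpace ℝ (Fin m)}
    (hy : y ∈ W) : 0 ≤ gradNormSq G v y := by
  by_cases h : fderiv ℝ v y = 0
  · simp [gradNormSq, pd, h]
  · exact (hG.gradNormSq_pos hy h).le

lemma sum_inv_mul_self {y : EuclideanSpace ℝ (Fin m)} (hy : y ∈ W) :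
    ∑ i, ∑ j, (G y)⁻¹ i j * G y i j = m := by
  have h := congrArg trace (nonsing_inv_mul (G y) (isUnit_iff_ne_zero.mpr (hG.det_ne_zero hy)))
  rw [trace_one, Fintype.card_fin] at h
  rw [← h, trace]
  simp only [diag_apply, mul_apply]
  exact Finset.sum_congr rfl fun i _ => Finset.sum_congr rfl fun j _ => by
    rw [hG.symm_apply hy i j]

end IsMetricOn

end Coordinates

section Manifold

variable {m n : ℕ}
  {M : Type*} [TopologicalSpace M] [ChartedSpace (EuclideanSpace ℝ (Fin m)) M]
  [IsManifold (𝓡 m) ∞ M]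
  {N : Type*} [TopologicalSpace N] [ChartedSpace (EuclideanSpace ℝ (Fin n)) N]
  [IsManifold (𝓡 n) ∞ N]

lemma contDiffOn_fCoord {f : M → ℝ} (hf : ContMDiff (𝓡 m) 𝓘(ℝ, ℝ) ∞ f) (p : M) :
    ContDiffOn ℝ ∞ (fCoord f p) (extChartAt (𝓡 m) p).target := by
  rw [← contMDiffOn_iff_contDiffOn]
  exact hf.comp_contMDiffOn (contMDiffOn_extChartAt_symm p)

/-- The squared norm of the gradient on `(M, g)`. -/
noncomputable def gradNorm (g : RMetric m M) (f : M → ℝ) (x : M) : ℝ :=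
  gradNormSq (gCoord g x) (fCoord f x) (extChartAt (𝓡 m) x x)

/-- Makes the pointwise definitions, each in the chart of its own point, available in one fixed
chart. -/
lemma chart_invariance (g : RMetric m M) {f : M → ℝ} (hf : ContMDiff (𝓡 m) 𝓘(ℝ, ℝ) ∞ f) (p : M)
    {y : EuclideanSpace ℝ (Fin m)} (hy : y ∈ (extChartAt (𝓡 m) p).target) :
    lap (gCoord g p) (fCoord f p) y = laplaceBeltrami g f ((extChartAt (𝓡 m) p).symm y) ∧
    gradNormSq (gCoord g p) (fCoord f p) y = gradNorm g f ((extChartAt (𝓡 m) p).symm y) := by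
  set x := (extChartAt (𝓡 m) p).symm y with hx
  have hyo : y ∈ overlap (m := m) p x := ⟨hy, mem_extChartAt_source (I := 𝓡 m) x⟩
  have hc : ∀ z ∈ overlap (m := m) p x, fCoord f p z = (fun z => fCoord f x (chartChange p x z)) z := by
    intro z hz
    simp only [fCoord, chartChange]
    rw [(extChartAt (𝓡 m) x).left_inv hz.2]
  have hG := (isMetricOn_gCoord g p).mono (isOpen_overlap p x) Set.inter_subset_left
  have h := hG.invariance (isMetricOn_gCoord g x) (contDiffOn_chartChange p x)
    (fun z hz => (extChartAt (𝓡 m) x).map_source hz.2)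
    (fun z hz => gCoord_change g p x hz) (contDiffOn_fCoord hf x) hyo
  rw [lap_congr (isOpen_overlap (m := m) p x) hc hyo, gradNormSq_congr (isOpen_overlap (m := m) p x) hc hyo]
  exact h

lemma laplaceBeltrami_add_smul (g : RMetric m M) {f₁ f₂ : M → ℝ}
    (h₁ : ContMDiff (𝓡 m) 𝓘(ℝ, ℝ) ∞ f₁) (h₂ : ContMDiff (𝓡 m) 𝓘(ℝ, ℝ) ∞ f₂) (r : ℝ) (x : M) :
    laplaceBeltrami g (fun x => f₁ x + r * f₂ x) x =
      laplaceBeltrami g f₁ x + r * laplaceBeltrami g f₂ x :=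
  (isMetricOn_gCoord g x).lap_add_smul (contDiffOn_fCoord h₁ x) (contDiffOn_fCoord h₂ x) r
    (mem_extChartAt_target x)

omit [IsManifold (𝓡 m) ∞ M] in
-- Even off the chart's target `fCoord` returns a value of `f`, so the global bound holds at every
-- `y`.
lemma isLocalMin_fCoord {f : M → ℝ} {x : M} (h : ∀ y, f x ≤ f y) :
    IsLocalMin (fCoord f x) (extChartAt (𝓡 m) x x) :=
  Filter.Eventually.of_forall fun y => by
    simpa only [fCoord, extChartAt_to_inv] using h _

/-- A superharmonic function on a compact connected Riemannian manifold is constant. -/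
theorem eq_of_laplaceBeltrami_nonpos [CompactSpace M] [ConnectedSpace M] (g : RMetric m M)
    {f : M → ℝ} (hf : ContMDiff (𝓡 m) 𝓘(ℝ, ℝ) ∞ f) (h : ∀ x, laplaceBeltrami g f x ≤ 0) (x y : M) :
    f x = f y := by
  obtain ⟨x₀, -, hx₀⟩ := isCompact_univ.exists_isMinOn Set.univ_nonempty hf.continuous.continuousOn
  have hmin : ∀ x, f x₀ ≤ f x := fun x => hx₀ (Set.mem_univ x)
  -- The minimum set is closed by continuity and open by the local maximum principle.
  have hclopen : IsClopen (f ⁻¹' {f x₀}) := by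
    refine ⟨isClosed_singleton.preimage hf.continuous, isOpen_iff_mem_nhds.mpr fun p hp => ?_⟩
    have h1 := (isMetricOn_gCoord g p).eventually_eq_of_lap_nonpos (contDiffOn_fCoord hf p)
      (fun y hy => by rw [(chart_invariance g hf p hy).1]; exact h _) (M := f x₀)
      (fun y _ => hmin _) (mem_extChartAt_target p)
      (by rw [fCoord, extChartAt_to_inv]; exact hp)
    have h2 : ∀ᶠ q in nhds p, fCoord f p (extChartAt (𝓡 m) p q) = f x₀ :=
      (continuousAt_extChartAt p).eventually h1
    filter_upwards [h2, extChartAt_source_mem_nhds (I := 𝓡 m) p] with q hq hqs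
    rw [fCoord, (extChartAt (𝓡 m) p).left_inv hqs] at hq
    exact hq
  have huniv := hclopen.eq_univ ⟨x₀, rfl⟩
  have key : ∀ x, f x = f x₀ := fun x => (huniv ▸ Set.mem_univ x : x ∈ f ⁻¹' {f x₀})
  rw [key x, key y]

theorem eq_of_laplaceBeltrami_nonneg [CompactSpace M] [ConnectedSpace M] (g : RMetric m M)
    {f : M → ℝ} (hf : ContMDiff (𝓡 m) 𝓘(ℝ, ℝ) ∞ f) (h : ∀ x, 0 ≤ laplaceBeltrami g f x) (x y : M) :
    f x = f y := by
  -- This is `-f`, in the shape to which `laplaceBeltrami_add_smul` applies.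
  have hneg : ContMDiff (𝓡 m) 𝓘(ℝ, ℝ) ∞ (fun x => f x + -2 * f x) :=
    hf.add (contMDiff_const.mul hf)
  have h1 := eq_of_laplaceBeltrami_nonpos g hneg (fun z => by
    rw [laplaceBeltrami_add_smul g hf hf]; linarith [h z]) x y
  linarith

variable {α : ℝ} {g : RMetric m M} {h : RMetric n N} {u : M → N} {f σ : M → ℝ}

namespace IsGradientAlmostRHSoliton

variable (hsol : IsGradientAlmostRHSoliton α g h u f σ)
include hsol

/-- The trace of the soliton equation. -/
lemma scalarS_add_laplaceBeltrami (x : M) :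
    scalarS α g h u x + laplaceBeltrami g f x = m * σ x := by
  have hG := isMetricOn_gCoord g x
  rw [← hG.sum_inv_mul_self (mem_extChartAt_target x), scalarS, laplaceBeltrami, lap]
  simp only [← Finset.sum_add_distrib, Finset.sum_mul, ← mul_add]
  refine Finset.sum_congr rfl fun i _ => Finset.sum_congr rfl fun j _ => ?_
  rw [hsol.ricci_eq x (u x) x (mem_extChartAt_source x) (mem_extChartAt_source (u x)) i j]
  ring

/-- Hamilton's identity for solitons with constant `σ`. -/
lemma exists_hamilton_const [ConnectedSpace M] {c : ℝ} (hσ : ∀ x, σ x = c) :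
    ∃ C, ∀ x, laplaceBeltrami g f x - gradNorm g f x + 2 * c * f x = C := by
  set Q : M → ℝ := fun x => laplaceBeltrami g f x - gradNorm g f x + 2 * c * f x with hQ
  have hloc : IsLocallyConstant Q := by
    rw [IsLocallyConstant.iff_eventually_eq]
    intro p
    -- The chart domain is cut down so that `u` stays in a single chart of `N`, where both soliton
    -- equations are available.
    set W := (extChartAt (𝓡 m) p).target ∩
      (extChartAt (𝓡 m) p).symm ⁻¹' (u ⁻¹' (extChartAt (𝓡 n) (u p)).source) with hW
    have hWo : IsOpen W := (continuousOn_extChartAt_symm p).isOpen_inter_preimage (isOpen_target p)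
      ((isOpen_extChartAt_source (u p)).preimage hsol.smooth_u.continuous)
    have hpW : extChartAt (𝓡 m) p p ∈ W :=
      ⟨mem_extChartAt_target p, by
        rw [Set.mem_preimage, Set.mem_preimage, extChartAt_to_inv]
        exact mem_extChartAt_source (u p)⟩
    have hG := (isMetricOn_gCoord g p).mono hWo Set.inter_subset_left
    have hU : ContDiffOn ℝ ∞ (uCoord (m := m) (n := n) u p (u p)) W := by
      rw [← contMDiffOn_iff_contDiffOn]
      have h1 : ContMDiffOn 𝓘(ℝ, EuclideanSpace ℝ (Fin m)) (𝓡 n) ∞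
          (fun y => u ((extChartAt (𝓡 m) p).symm y)) W :=
        hsol.smooth_u.comp_contMDiffOn
          ((contMDiffOn_extChartAt_symm p).mono Set.inter_subset_left)
      exact (contMDiffOn_extChartAt (x := u p)).comp h1 fun y hy => by
        simpa only [extChartAt_source, Set.mem_preimage] using hy.2
    obtain ⟨q, hq, hqe, hqd⟩ := hG.pd_soliton (isMetricOn_gCoord h (u p)) hU
      (fun y hy => (extChartAt (𝓡 n) (u p)).map_source hy.2)
      ((contDiffOn_fCoord hsol.smooth_f p).mono Set.inter_subset_left) (α := α) (c := c)
      (fun y hy i j => by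
        have := hsol.ricci_eq p (u p) ((extChartAt (𝓡 m) p).symm y)
          ((extChartAt (𝓡 m) p).map_target hy.1) hy.2 i j
        rwa [(extChartAt (𝓡 m) p).right_inv hy.1, hσ] at this)
      (fun y hy ν => by
        have := hsol.tension_eq p (u p) ((extChartAt (𝓡 m) p).symm y)
          ((extChartAt (𝓡 m) p).map_target hy.1) hy.2 ν
        rwa [(extChartAt (𝓡 m) p).right_inv hy.1] at this)
    have hqQ : ∀ y ∈ W, q y = Q ((extChartAt (𝓡 m) p).symm y) := by
      intro y hy
      have h1 := chart_invariance g hsol.smooth_f p hy.1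
      rw [hqe y hy, h1.1, h1.2]
      rfl
    obtain ⟨ε, hε, hεW⟩ := Metric.isOpen_iff.mp hWo _ hpW
    -- `W` need not be connected, so the vanishing differential is integrated over a ball.
    have hconst : ∀ y ∈ Metric.ball (extChartAt (𝓡 m) p p) ε, q y = q (extChartAt (𝓡 m) p p) := by
      intro y hy
      refine Metric.isOpen_ball.is_const_of_fderiv_eq_zero
        (convex_ball (extChartAt (𝓡 m) p p) ε).isPreconnected
        ((hq.mono hεW).differentiableOn (by simp)) (fun z hz => ?_) hy (Metric.mem_ball_self hε)
      ext w
      rw [fderiv_eq_sum_pd]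
      exact Finset.sum_eq_zero fun e _ => by rw [hqd z (hεW hz), mul_zero]
    have h3 : ∀ᶠ x in nhds p, extChartAt (𝓡 m) p x ∈ Metric.ball (extChartAt (𝓡 m) p p) ε :=
      (continuousAt_extChartAt p).eventually (Metric.ball_mem_nhds _ hε)
    filter_upwards [h3, extChartAt_source_mem_nhds (I := 𝓡 m) p] with x hx hxs
    have h4 := hconst _ hx
    rwa [hqQ _ (hεW hx), hqQ _ hpW, (extChartAt (𝓡 m) p).left_inv hxs, extChartAt_to_inv] at h4
  obtain ⟨x₀⟩ := (inferInstance : Nonempty M)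
  exact ⟨Q x₀, fun x => hloc.apply_eq_of_preconnectedSpace x x₀⟩

/-- A compact soliton with constant `σ ≤ 0` is trivial. -/
lemma eq_of_sigma_const [CompactSpace M] [ConnectedSpace M] {c : ℝ} (hc : c ≤ 0)
    (hσ : ∀ x, σ x = c) (x y : M) : f x = f y := by
  obtain ⟨C, hC⟩ := hsol.exists_hamilton_const hσ
  obtain ⟨x₀, -, hx₀⟩ := isCompact_univ.exists_isMinOn Set.univ_nonempty
    hsol.smooth_f.continuous.continuousOn
  have hmin : ∀ x, f x₀ ≤ f x := fun x => hx₀ (Set.mem_univ x)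
  have hloc := isLocalMin_fCoord (m := m) hmin
  have h1 : 0 ≤ laplaceBeltrami g f x₀ :=
    (isMetricOn_gCoord g x₀).lap_nonneg_of_isLocalMin (contDiffOn_fCoord hsol.smooth_f x₀)
      (mem_extChartAt_target x₀) hloc
  have h2 : gradNorm g f x₀ = 0 := by
    simp only [gradNorm, gradNormSq, pd_eq_zero_of_isLocalMin hloc, mul_zero,
      Finset.sum_const_zero]
  refine eq_of_laplaceBeltrami_nonneg g hsol.smooth_f (fun z => ?_) x y
  have h3 : 0 ≤ gradNorm g f z :=
    (isMetricOn_gCoord g z).gradNormSq_nonneg _ (mem_extChartAt_target z)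
  have h4 := hC z
  have h5 := hC x₀
  -- The sign of `c` is used here: `-c (f z - f x₀) ≥ 0`, so comparing the identity at `z` and at
  -- the minimum `x₀` gives `Δf(z) ≥ 0`.
  have h6 := mul_nonneg (neg_nonneg.mpr hc) (sub_nonneg.mpr (hmin z))
  linarith

end IsGradientAlmostRHSoliton

lemma laplaceBeltrami_eq_zero_of_const (g : RMetric m M) {f : M → ℝ} (hf : ∀ x y, f x = f y)
    (x : M) : laplaceBeltrami g f x = 0 := by
  have e : fCoord (m := m) f x = fun _ => f x := funext fun y => hf _ _
  have h1 : ∀ (c : ℝ) (i : Fin m), pd i (fun _ => c) = fun _ => 0 := by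
    intro c i; funext y; simp [pd]
  simp [laplaceBeltrami, lap, hess, e, h1]

end Manifold

end RHSoliton

theorem mainTheorem9 {m n : ℕ}
    {M : Type*} [TopologicalSpace M] [ChartedSpace (EuclideanSpace ℝ (Fin m)) M]
    [IsManifold (𝓡 m) ∞ M] [T2Space M] [CompactSpace M] [ConnectedSpace M]
    {N : Type*} [TopologicalSpace N] [ChartedSpace (EuclideanSpace ℝ (Fin n)) N]
    [IsManifold (𝓡 n) ∞ N] [T2Space N]
    (α : ℝ) (g : RHSoliton.RMetric m M) (h : RHSoliton.RMetric n N)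
    (u : M → N) (f σ : M → ℝ)
    (hsol : RHSoliton.IsGradientAlmostRHSoliton α g h u f σ)
    (htype : RHSoliton.IsSteady σ ∨
      (RHSoliton.IsExpanding σ ∧
        ((∀ x, RHSoliton.laplaceBeltrami g σ x ≤ 0) ∨
          (∀ x, RHSoliton.scalarS α g h u x = m * ⨅ y, σ y)))) :
    RHSoliton.IsTrivial f ∧ ∀ x, RHSoliton.scalarS α g h u x = m * ⨅ y, σ y := by
  obtain ⟨x₀⟩ := (inferInstance : Nonempty M)
  have of_const : ∀ c : ℝ, c ≤ 0 → (∀ x, σ x = c) →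
      RHSoliton.IsTrivial f ∧ ∀ x, RHSoliton.scalarS α g h u x = m * ⨅ y, σ y := by
    intro c hc hσ
    have hf := hsol.eq_of_sigma_const hc hσ
    refine ⟨⟨f x₀, fun x => hf x x₀⟩, fun x => ?_⟩
    have h1 := hsol.scalarS_add_laplaceBeltrami x
    rw [RHSoliton.laplaceBeltrami_eq_zero_of_const g hf, add_zero] at h1
    rw [h1, hσ x, funext hσ, ciInf_const]
  rcases htype with hst | ⟨hexp, hlap | hS⟩
  · exact of_const 0 le_rfl hst
  · exact of_const (σ x₀) (hexp x₀).le fun x =>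
      RHSoliton.eq_of_laplaceBeltrami_nonpos g hsol.smooth_sigma hlap x x₀
  · refine ⟨⟨f x₀, fun x => ?_⟩, hS⟩
    refine RHSoliton.eq_of_laplaceBeltrami_nonneg g hsol.smooth_f (fun z => ?_) x x₀
    have h1 := hsol.scalarS_add_laplaceBeltrami z
    -- With `S = mσ_*` the traced equation reads `Δf = m(σ - σ_*)`, so this bound makes `f`
    -- subharmonic; compactness guarantees that the infimum is a genuine lower bound.
    have h2 : ⨅ y, σ y ≤ σ z :=
      ciInf_le (isCompact_range hsol.smooth_sigma.continuous).bddBelow z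
    have h3 := mul_le_mul_of_nonneg_left h2 (Nat.cast_nonneg m : (0 : ℝ) ≤ m)
    rw [hS z] at h1
    linarith
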